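/- Identify $\mathbb{C}^m\otimes\mathbb{C}^n$ with the state space of a bipartite quantum system $AB$, and let $|0\rangle,|1\rangle,|2\rangle$ be the standard basis of $\mathbb{C}^3$, with $|i,j\rangle=|i\rangle\otimes|j\rangle$. A subspace $V\subseteq\mathcal{H}_A\otimes\mathcal{H}_B$ is called an *entanglement-breaking (EB) space* if for all finite-dimensional systems $a,b$ and every unit vector $|\Psi\rangle\in V\otimes\mathcal{H}_{ab}$ the state $\operatorname{Tr}_B|\Psi\rangle\langle\Psi|$ is separable with respect to the bipartition $A:ab$, i.e. it equals a finite convex combination $\sum_n q_n\,|\mu_n\rangle\langle\mu_n|_A\otimes|\nu_n\rangle\langle\nu_n|_{ab}$ of pure product states. A subspace $V\subseteq\mathbb{C}^k\otimes\mathbb{C}^n$ is *EB-convertible* to a subspace $V'\subseteq\mathbb{C}^m\otimes\mathbb{C}^n$ if $V'=(W\otimes U)V$ for some complex $m\times k$ matrix $W$ (not necessarily square or invertible) and some unitary $n\times n$ matrix $U$. **Theorem.** Let $m$ be a natural number and let $V\subseteq\mathbb{C}^m\otimes\mathbb{C}^3$ be a subspace of dimension $2$. Then $V$ is an EB space if and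 only if at least one of the following subspaces of $\mathbb{C}^3\otimes\mathbb{C}^3$ is EB-convertible to $V$: 1. $\operatorname{span}\{|0,0\rangle,\ |1,1\rangle+|2,2\rangle\}$; 2. $\operatorname{span}\{|0,0\rangle+|1,1\rangle,\ |1,1\rangle+|2,2\rangle\}$; 3. $\operatorname{span}\{|0,0\rangle+|1,1\rangle,\ |0,1\rangle+|1\rangle\otimes(d|0\rangle+fe^{i\theta}|1\rangle+g|2\rangle)\}$ for some real numbers $g>0$ and $d,f,\theta\ge 0$ satisfying $$-1-f^2+g^2-d^2(-2+d^2+f^2+g^2)+2df^2\cos 2\theta\ \ge\ 0 .$$ -/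

import Mathlib

open scoped Kronecker Matrix

noncomputable section

/-- The product vector `x ⊗ y` in `ℂ^I ⊗ ℂ^J`, where `ℂ^I ⊗ ℂ^J` is the space of functions
`I × J → ℂ` (coordinates in the product basis `|i, j⟩`). -/
def tensorVec {I J : Type*} (x : I → ℂ) (y : J → ℂ) : I × J → ℂ :=
  fun p => x p.1 * y p.2

/-- The computational basis vector `|j⟩` of `ℂ^3`. -/
def ket3 (j : Fin 3) : Fin 3 → ℂ := Pi.single j 1

/-- `Ψ` is a unit vector for the standard Hermitian inner product. -/
def IsUnitVec {I : Type*} [Fintype I] (Ψ : I → ℂ) : Prop := star Ψ ⬝ᵥ Ψ = 1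

/-- The rank-one operator `|Ψ⟩⟨Ψ|`. -/
def ketBra {I : Type*} (Ψ : I → ℂ) : Matrix I I ℂ := Matrix.vecMulVec Ψ (star Ψ)

/-- For a subspace `V` of `ℂ^I`, the subspace `V ⊗ ℂ^J` of `ℂ^I ⊗ ℂ^J`. -/
def tensorFull {I : Type*} (V : Submodule ℂ (I → ℂ)) (J : Type*) :
    Submodule ℂ (I × J → ℂ) :=
  Submodule.span ℂ {Φ | ∃ v ∈ V, ∃ w : J → ℂ, Φ = tensorVec v w}

/-- The partial trace over the system `B` of an operator on `(A ⊗ B) ⊗ C`. -/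
def partialTraceB {A B C : Type*} [Fintype B]
    (ρ : Matrix ((A × B) × C) ((A × B) × C) ℂ) : Matrix (A × C) (A × C) ℂ :=
  fun x y => ∑ b, ρ ((x.1, b), x.2) ((y.1, b), y.2)

/-- A bipartite operator is a separable state if it is a finite convex combination
`∑ q_n |μ_n⟩⟨μ_n| ⊗ |ν_n⟩⟨ν_n|` of pure product states. -/
def IsSeparableState {A C : Type*} [Fintype A] [Fintype C]
    (ρ : Matrix (A × C) (A × C) ℂ) : Prop :=
  ∃ (N : ℕ) (q : Fin N → ℝ) (μ : Fin N → A → ℂ) (ν : Fin N → C → ℂ),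
    (∀ n, 0 ≤ q n) ∧ ∑ n, q n = 1 ∧
    (∀ n, IsUnitVec (μ n)) ∧ (∀ n, IsUnitVec (ν n)) ∧
    ρ = ∑ n, (q n : ℂ) • (ketBra (μ n) ⊗ₖ ketBra (ν n))

/-- `V ⊆ ℂ^A ⊗ ℂ^B` is an entanglement-breaking space: for all systems `a`, `b` and every pure
state `Ψ` in `V ⊗ H_ab`, the state obtained by tracing out `B` is separable between `A` and
`ab`. -/
def IsEBSpace {A B : Type*} [Fintype A] [Fintype B] (V : Submodule ℂ (A × B → ℂ)) : Prop :=
  ∀ (p q : ℕ) (Ψ : (A × B) × (Fin p × Fin q) → ℂ),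
    Ψ ∈ tensorFull V (Fin p × Fin q) → IsUnitVec Ψ →
      IsSeparableState (partialTraceB (ketBra Ψ))

/-- `V` is EB-convertible to `V'`: `V' = (W ⊗ U) V` for some matrix `W` on the first system,
not necessarily square or invertible, and some unitary matrix `U` on the second system. -/
def EBConvertible {A A' B : Type*} [Fintype A] [Fintype B] [DecidableEq B]
    (V : Submodule ℂ (A × B → ℂ)) (V' : Submodule ℂ (A' × B → ℂ)) : Prop :=
  ∃ (W : Matrix A' A ℂ) (U : Matrix B B ℂ), U ∈ Matrix.unitaryGroup B ℂ ∧
    V' = V.map (Matrix.mulVecLin (W ⊗ₖ U))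

/-- `span {|0,0⟩, |1,1⟩ + |2,2⟩}`. -/
def ebModel₁ : Submodule ℂ (Fin 3 × Fin 3 → ℂ) :=
  Submodule.span ℂ {tensorVec (ket3 0) (ket3 0),
    tensorVec (ket3 1) (ket3 1) + tensorVec (ket3 2) (ket3 2)}

/-- `span {|0,0⟩ + |1,1⟩, |1,1⟩ + |2,2⟩}`. -/
def ebModel₂ : Submodule ℂ (Fin 3 × Fin 3 → ℂ) :=
  Submodule.span ℂ {tensorVec (ket3 0) (ket3 0) + tensorVec (ket3 1) (ket3 1),
    tensorVec (ket3 1) (ket3 1) + tensorVec (ket3 2) (ket3 2)}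

/-- `span {|0,0⟩ + |1,1⟩, |0,1⟩ + |1⟩ (d |0⟩ + f e^{iθ} |1⟩ + g |2⟩)}`. -/
def ebModel₃ (d f θ g : ℝ) : Submodule ℂ (Fin 3 × Fin 3 → ℂ) :=
  Submodule.span ℂ {tensorVec (ket3 0) (ket3 0) + tensorVec (ket3 1) (ket3 1),
    tensorVec (ket3 0) (ket3 1) +
      tensorVec (ket3 1)
        ((d : ℂ) • ket3 0 + ((f : ℂ) * Complex.exp (Complex.I * (θ : ℂ))) • ket3 1 +
          (g : ℂ) • ket3 2)}

end

/-! A plane `V` is handled through two coefficient matrices `M`, `N` spanning it. The proof passes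
through product resolutions: finitely many vectors `t_n` of the second factor with `∑ |t_n⟩⟨t_n| =
1` such that `M t_n` and `N t_n` are parallel for every `n`. Such vectors compute the partial trace
as a sum of product terms (`HasProductResolution.isEBSpace`). Conversely, separability of the
partial trace of a multiple of `M ⊗ e₀ + N ⊗ e₁` produces them, because two factorizations `Φ Φᴴ = P
Pᴴ` differ by a coisometry (`IsEBSpace.exists_isProductResolution`).

Sufficiency then asks for a resolution of each model: the standard basis for the diagonal models,
and an explicit five-vector frame for the third (`hasProductResolution_qubit`).

For necessity, a generic `W = M + x N` turns the `t_n` into generalized eigenvectors, `W Z t_n = l_n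
W t_n` with `W Z = N`. On the support of `W` this forces a partial transpose inequality
(`posSemidef_of_resolution`). If `W` is injective it reads `Z Zᴴ ≥ Zᴴ Z`; equality of traces makes
`Z` normal, and diagonalizing gives the first two models. If `W` has rank one, both matrices are
trivially diagonal. If `W` has rank two, unitary changes of basis either reach a diagonal case or
bring `Z` to the shape of the third model, whose numerical condition is the determinant of the 2×2
inequality. -/

noncomputable section

/-! ### Coefficient matrices and the models in matrix form. -/

/-- The vector of `ℂ^I ⊗ ℂ^J` with coefficient matrix `M`. -/
def vecOf {I J : Type*} (M : Matrix I J ℂ) : I × J → ℂ := fun p => M p.1 p.2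

lemma vecOf_add {I J : Type*} (M N : Matrix I J ℂ) : vecOf (M + N) = vecOf M + vecOf N := rfl

lemma vecOf_smul {I J : Type*} (c : ℂ) (M : Matrix I J ℂ) : vecOf (c • M) = c • vecOf M := rfl

lemma kronecker_mulVec_vecOf {I I' J J' : Type*} [Fintype I] [Fintype J]
    (W : Matrix I' I ℂ) (U : Matrix J' J ℂ) (M : Matrix I J ℂ) :
    (W ⊗ₖ U) *ᵥ vecOf M = vecOf (W * M * Uᵀ) := by
  ext ⟨i, j⟩
  simp only [Matrix.mulVec, dotProduct, Fintype.sum_prod_type, Matrix.kroneckerMap_apply, vecOf,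
    Matrix.mul_apply, Matrix.transpose_apply, Finset.sum_mul]
  rw [Finset.sum_comm]
  exact Finset.sum_congr rfl fun _ _ => Finset.sum_congr rfl fun _ _ => by ring

/-- The image of the model contains both generators of `V` and has dimension at most 2, so it equals
`V`; invertibility of the coefficients `a₁ b₁ a₂ b₂` need not be checked. -/
lemma ebConvertible_of_span_pair {I J K : Type*} [Fintype I] [Fintype J] [DecidableEq J]
    [Fintype K]
    {V : Submodule ℂ (I × J → ℂ)} (hV : Module.finrank ℂ V = 2)
    {M₁ M₂ : Matrix I J ℂ} (hM : V = Submodule.span ℂ {vecOf M₁, vecOf M₂})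
    {N₁ N₂ : Matrix K J ℂ} (W : Matrix I K ℂ) {U : Matrix J J ℂ}
    (hU : U ∈ Matrix.unitaryGroup J ℂ) (a₁ b₁ a₂ b₂ : ℂ)
    (h₁ : M₁ = W * (a₁ • N₁ + b₁ • N₂) * U) (h₂ : M₂ = W * (a₂ • N₁ + b₂ • N₂) * U) :
    EBConvertible (Submodule.span ℂ {vecOf N₁, vecOf N₂}) V := by
  classical
  refine ⟨W, Uᵀ, Matrix.transpose_mem_unitaryGroup_iff.mpr hU, ?_⟩
  have key : ∀ a b : ℂ, vecOf (W * (a • N₁ + b • N₂) * U) ∈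
      (Submodule.span ℂ {vecOf N₁, vecOf N₂}).map (Matrix.mulVecLin (W ⊗ₖ Uᵀ)) := by
    intro a b
    refine ⟨a • vecOf N₁ + b • vecOf N₂, Submodule.mem_span_pair.mpr ⟨a, b, rfl⟩, ?_⟩
    rw [Matrix.mulVecLin_apply, ← vecOf_smul, ← vecOf_smul, ← vecOf_add, kronecker_mulVec_vecOf,
      Matrix.transpose_transpose]
  refine Submodule.eq_of_le_of_finrank_le ?_ ?_
  · rw [hM, Submodule.span_le]
    rintro _ (rfl | rfl)
    · rw [h₁]; exact key _ _
    · rw [h₂]; exact key _ _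
  · rw [hV]
    refine (Submodule.finrank_map_le _ _).trans ?_
    rw [← Matrix.range_cons_cons_empty _ _ ![]]
    exact finrank_range_le_card _

lemma ebModel₁_eq : ebModel₁ = Submodule.span ℂ
    {vecOf (Matrix.diagonal ![1, 0, 0]), vecOf (Matrix.diagonal ![0, 1, 1])} := by
  unfold ebModel₁
  congr 2
  · ext ⟨i, j⟩
    fin_cases i <;> fin_cases j <;> simp [tensorVec, ket3, vecOf]
  · congr 1
    ext ⟨i, j⟩
    fin_cases i <;> fin_cases j <;> simp [tensorVec, ket3, vecOf]

lemma ebModel₂_eq : ebModel₂ = Submodule.span ℂ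
    {vecOf (Matrix.diagonal ![1, 1, 0]), vecOf (Matrix.diagonal ![0, 1, 1])} := by
  unfold ebModel₂
  congr 2
  · ext ⟨i, j⟩
    fin_cases i <;> fin_cases j <;> simp [tensorVec, ket3, vecOf]
  · congr 1
    ext ⟨i, j⟩
    fin_cases i <;> fin_cases j <;> simp [tensorVec, ket3, vecOf]

lemma ebModel₃_eq (d f θ g : ℝ) : ebModel₃ d f θ g = Submodule.span ℂ
    {vecOf !![1, 0, 0; 0, 1, 0; 0, 0, 0],
      vecOf !![0, 1, 0; (d : ℂ), f * Complex.exp (Complex.I * θ), g; 0, 0, 0]} := by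
  unfold ebModel₃
  congr 2
  · ext ⟨i, j⟩
    fin_cases i <;> fin_cases j <;> simp [tensorVec, ket3, vecOf]
  · congr 1
    ext ⟨i, j⟩
    fin_cases i <;> fin_cases j <;> simp [tensorVec, ket3, vecOf]

/-! ### Planes of simultaneously diagonal matrices. -/

/-- Being convertible from one of the models of diagonal type. -/
def DiagConvertible {I : Type*} [Fintype I] (V : Submodule ℂ (I × Fin 3 → ℂ)) : Prop :=
  EBConvertible ebModel₁ V ∨ EBConvertible ebModel₂ V

/-- Rescaling the columns of `A` rescales the coordinates of `c` and `c'`, so only the zero pattern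
of the linear relation `n` between coordinates matters. Exactly two nonzero entries give the first
model; one or three give the second. -/
lemma diagConvertible_of_annihilator {I : Type*} [Fintype I]
    {V : Submodule ℂ (I × Fin 3 → ℂ)} (hV : Module.finrank ℂ V = 2)
    (A : Matrix I (Fin 3) ℂ) (c c' n : Fin 3 → ℂ) {U : Matrix (Fin 3) (Fin 3) ℂ}
    (hU : U ∈ Matrix.unitaryGroup (Fin 3) ℂ)
    (hM : V = Submodule.span ℂ
      {vecOf (A * Matrix.diagonal c * U), vecOf (A * Matrix.diagonal c' * U)})
    (hn : n ≠ 0) (hnc : c ⬝ᵥ n = 0) (hnc' : c' ⬝ᵥ n = 0)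
    (hz : n 0 = 0 ∨ ∀ i, n i ≠ 0) : DiagConvertible V := by
  unfold DiagConvertible
  rw [ebModel₁_eq, ebModel₂_eq]
  simp only [dotProduct, Fin.sum_univ_three] at hnc hnc'
  have two (s : Fin 3 → ℂ) (a b a' b' : ℂ)
      (h : c = ![s 0 * a, s 1 * (a + b), s 2 * b])
      (h' : c' = ![s 0 * a', s 1 * (a' + b'), s 2 * b']) :
      EBConvertible (Submodule.span ℂ {vecOf (Matrix.diagonal (![1, 1, 0] : Fin 3 → ℂ)),
        vecOf (Matrix.diagonal ![0, 1, 1])}) V := by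
    refine ebConvertible_of_span_pair hV hM (A * Matrix.diagonal s) hU a b a' b' ?_ ?_
    · rw [Matrix.mul_assoc A (Matrix.diagonal s), ← Matrix.diagonal_smul, ← Matrix.diagonal_smul,
        Matrix.diagonal_add, Matrix.diagonal_mul_diagonal, h]
      congr 3
      ext i
      fin_cases i <;> simp
    · rw [Matrix.mul_assoc A (Matrix.diagonal s), ← Matrix.diagonal_smul, ← Matrix.diagonal_smul,
        Matrix.diagonal_add, Matrix.diagonal_mul_diagonal, h']
      congr 3
      ext i
      fin_cases i <;> simp
  have one (s : Fin 3 → ℂ) (a b a' b' : ℂ)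
      (h : c = ![s 0 * a, s 1 * b, s 2 * b])
      (h' : c' = ![s 0 * a', s 1 * b', s 2 * b']) :
      EBConvertible (Submodule.span ℂ {vecOf (Matrix.diagonal (![1, 0, 0] : Fin 3 → ℂ)),
        vecOf (Matrix.diagonal ![0, 1, 1])}) V := by
    refine ebConvertible_of_span_pair hV hM (A * Matrix.diagonal s) hU a b a' b' ?_ ?_
    · rw [Matrix.mul_assoc A (Matrix.diagonal s), ← Matrix.diagonal_smul, ← Matrix.diagonal_smul,
        Matrix.diagonal_add, Matrix.diagonal_mul_diagonal, h]
      congr 3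
      ext i
      fin_cases i <;> simp
    · rw [Matrix.mul_assoc A (Matrix.diagonal s), ← Matrix.diagonal_smul, ← Matrix.diagonal_smul,
        Matrix.diagonal_add, Matrix.diagonal_mul_diagonal, h']
      congr 3
      ext i
      fin_cases i <;> simp
  rcases hz with h0 | hz
  · simp only [h0, mul_zero, zero_add] at hnc hnc'
    by_cases h1 : n 1 = 0
    · have h2 : n 2 ≠ 0 := fun h2 => hn (by ext i; fin_cases i <;> simp [h0, h1, h2])
      have e : c 2 = 0 := by simpa [h1, h2] using hnc
      have e' : c' 2 = 0 := by simpa [h1, h2] using hnc'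
      refine Or.inr (two ![1, 1, 0] (c 0) (c 1 - c 0) (c' 0) (c' 1 - c' 0) ?_ ?_) <;>
        (ext i; fin_cases i <;> simp [e, e'])
    · by_cases h2 : n 2 = 0
      · have e : c 1 = 0 := by simpa [h1, h2] using hnc
        have e' : c' 1 = 0 := by simpa [h1, h2] using hnc'
        refine Or.inr (two ![1, 0, 1] (c 0) (c 2) (c' 0) (c' 2) ?_ ?_) <;>
          (ext i; fin_cases i <;> simp [e, e'])
      · refine Or.inl (one ![1, 1, -n 1 / n 2] (c 0) (c 1) (c' 0) (c' 1) ?_ ?_)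
        · ext i
          fin_cases i <;> simp
          field_simp
          linear_combination hnc
        · ext i
          fin_cases i <;> simp
          field_simp
          linear_combination hnc'
  · have h0 := hz 0
    have h1 := hz 1
    have h2 := hz 2
    -- The relation says `-n₁ c₁ = n₀ c₀ + n₂ c₂`, which is the pattern `(a, a + b, b)` after
    -- scaling by `n`.
    refine Or.inr (two ![1 / n 0, -1 / n 1, 1 / n 2] (n 0 * c 0) (n 2 * c 2)
      (n 0 * c' 0) (n 2 * c' 2) ?_ ?_)
    · ext i
      fin_cases i
      · simp [h0]
      · simp
        field_simp
        linear_combination hnc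
      · simp [h2]
    · ext i
      fin_cases i
      · simp [h0]
      · simp
        field_simp
        linear_combination hnc'
      · simp [h2]

lemma submatrix_mem_unitaryGroup {J : Type*} [Fintype J] [DecidableEq J] {U : Matrix J J ℂ}
    (hU : U ∈ Matrix.unitaryGroup J ℂ) (σ : Equiv.Perm J) :
    U.submatrix σ id ∈ Matrix.unitaryGroup J ℂ := by
  rw [Matrix.mem_unitaryGroup_iff, Matrix.star_eq_conjTranspose] at hU ⊢
  rw [Matrix.conjTranspose_submatrix]
  change U.submatrix σ (Equiv.refl J) * Uᴴ.submatrix (Equiv.refl J) σ = 1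
  rw [Matrix.submatrix_mul_equiv, hU, Matrix.submatrix_one_equiv]

lemma mul_diagonal_mul_submatrix {I J K : Type*} [Fintype J] [DecidableEq J]
    (A : Matrix I J ℂ) (c : J → ℂ) (U : Matrix J K ℂ) (σ : Equiv.Perm J) :
    A.submatrix id σ * Matrix.diagonal (c ∘ σ) * U.submatrix σ id = A * Matrix.diagonal c * U := by
  rw [← Matrix.submatrix_diagonal_equiv, Matrix.submatrix_mul_equiv, Matrix.submatrix_mul_equiv,
    Matrix.submatrix_id_id]

lemma linearIndependent_of_finrank_span_pair {E : Type*} [AddCommGroup E] [Module ℂ E] {x y : E}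
    (h : Module.finrank ℂ (Submodule.span ℂ {x, y}) = 2) : LinearIndependent ℂ ![x, y] := by
  rw [linearIndependent_iff_card_eq_finrank_span]
  rw [Set.finrank, Matrix.range_cons_cons_empty, h, Fintype.card_fin]

/-- A plane spanned by two operators that are diagonal in a common orthonormal basis of the second
factor is convertible from a model of diagonal type. -/
lemma diagConvertible_of_diagonal {I : Type*} [Fintype I]
    {V : Submodule ℂ (I × Fin 3 → ℂ)} (hV : Module.finrank ℂ V = 2)
    (A : Matrix I (Fin 3) ℂ) (c c' : Fin 3 → ℂ) {U : Matrix (Fin 3) (Fin 3) ℂ}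
    (hU : U ∈ Matrix.unitaryGroup (Fin 3) ℂ)
    (hM : V = Submodule.span ℂ
      {vecOf (A * Matrix.diagonal c * U), vecOf (A * Matrix.diagonal c' * U)}) :
    DiagConvertible V := by
  have hli := linearIndependent_of_finrank_span_pair (hM ▸ hV)
  have hcc : LinearIndependent ℂ ![c, c'] := by
    rw [LinearIndependent.pair_iff] at hli ⊢
    intro s t hst
    refine hli s t ?_
    have h : s • (A * Matrix.diagonal c * U) + t • (A * Matrix.diagonal c' * U) =
        A * Matrix.diagonal (s • c + t • c') * U := by
      have : Matrix.diagonal (s • c + t • c') =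
          s • Matrix.diagonal c + t • Matrix.diagonal c' := by
        rw [← Matrix.diagonal_smul, ← Matrix.diagonal_smul, Matrix.diagonal_add]
        rfl
      rw [this, Matrix.mul_add, Matrix.add_mul, Matrix.mul_smul, Matrix.mul_smul,
        Matrix.smul_mul, Matrix.smul_mul]
    rw [← vecOf_smul, ← vecOf_smul, ← vecOf_add, h, hst, Matrix.diagonal_zero', Matrix.mul_zero,
      Matrix.zero_mul]
    rfl
  -- The cross product is the relation satisfied by both diagonals. If it has a zero entry, a
  -- permutation moves that entry to position 0.
  have hn := crossProduct_ne_zero_iff_linearIndependent.mpr hcc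
  set n := crossProduct c c' with hndef
  have hnc : c ⬝ᵥ n = 0 := dot_self_cross c c'
  have hnc' : c' ⬝ᵥ n = 0 := dot_cross_self c c'
  by_cases hz : ∀ i, n i ≠ 0
  · exact diagConvertible_of_annihilator hV A c c' n hU hM hn hnc hnc' (Or.inr hz)
  · push Not at hz
    obtain ⟨j, hj⟩ := hz
    let σ : Equiv.Perm (Fin 3) := Equiv.swap 0 j
    refine diagConvertible_of_annihilator hV (A.submatrix id σ) (c ∘ σ) (c' ∘ σ) (n ∘ σ)
      (submatrix_mem_unitaryGroup hU σ) ?_ ?_ ?_ ?_ (Or.inl ?_)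
    · rw [mul_diagonal_mul_submatrix, mul_diagonal_mul_submatrix]
      exact hM
    · intro h
      exact hn (by ext i; simpa using congrFun h (σ.symm i))
    · rw [comp_equiv_dotProduct_comp_equiv, hnc]
    · rw [comp_equiv_dotProduct_comp_equiv, hnc']
    · simpa [σ] using hj

/-! ### Rank-one operators and separable states. -/

lemma dotProduct_star_self_eq {I : Type*} [Fintype I] (x : I → ℂ) :
    star x ⬝ᵥ x = ((∑ i, ‖x i‖ ^ 2 : ℝ) : ℂ) := by
  simp only [dotProduct, Pi.star_apply, Complex.ofReal_sum]
  refine Finset.sum_congr rfl fun i _ => ?_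
  rw [Complex.star_def, mul_comm, Complex.mul_conj, Complex.normSq_eq_norm_sq]

lemma ketBra_smul {I : Type*} (c : ℂ) (x : I → ℂ) :
    ketBra (c • x) = (c * star c) • ketBra x := by
  ext i j
  simp [ketBra, Matrix.vecMulVec_apply]
  ring

lemma exists_isUnitVec_smul {I : Type*} [Fintype I] {x : I → ℂ} (hx : x ≠ 0) :
    ∃ r : ℝ, 0 < r ∧ IsUnitVec (((r⁻¹ : ℝ) : ℂ) • x) ∧
      ketBra x = ((r ^ 2 : ℝ) : ℂ) • ketBra (((r⁻¹ : ℝ) : ℂ) • x) := by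
  have hs : 0 < ∑ i, ‖x i‖ ^ 2 := by
    obtain ⟨i, hi⟩ := Function.ne_iff.mp hx
    exact Finset.sum_pos' (fun _ _ => by positivity)
      ⟨i, Finset.mem_univ _, pow_pos (norm_pos_iff.mpr hi) 2⟩
  refine ⟨√(∑ i, ‖x i‖ ^ 2), Real.sqrt_pos.mpr hs, ?_, ?_⟩
  · rw [IsUnitVec, star_smul, smul_dotProduct, dotProduct_smul, dotProduct_star_self_eq,
      Complex.star_def, Complex.conj_ofReal, smul_eq_mul, smul_eq_mul, ← Complex.ofReal_mul,
      ← Complex.ofReal_mul, ← Complex.ofReal_one]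
    congr 1
    field_simp
    rw [Real.sq_sqrt hs.le]
  · rw [ketBra_smul, smul_smul, Complex.star_def, Complex.conj_ofReal, ← Complex.ofReal_mul,
      ← Complex.ofReal_mul]
    have : √(∑ i, ‖x i‖ ^ 2) ≠ 0 := (Real.sqrt_pos.mpr hs).ne'
    have h : √(∑ i, ‖x i‖ ^ 2) ^ 2 * ((√(∑ i, ‖x i‖ ^ 2))⁻¹ * (√(∑ i, ‖x i‖ ^ 2))⁻¹) = 1 := by
      field_simp
    rw [h, Complex.ofReal_one, one_smul]

lemma isUnitVec_single {I : Type*} [Fintype I] [DecidableEq I] (i : I) :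
    IsUnitVec (Pi.single i 1 : I → ℂ) := by
  simp [IsUnitVec]

lemma exists_ketBra_eq_smul {I : Type*} [Fintype I] [Nonempty I] (x : I → ℂ) :
    ∃ (q : ℝ) (u : I → ℂ), 0 ≤ q ∧ IsUnitVec u ∧ ketBra x = (q : ℂ) • ketBra u := by
  classical
  by_cases hx : x = 0
  · refine ⟨0, _, le_rfl, isUnitVec_single (Classical.arbitrary I), ?_⟩
    ext i j
    simp [hx, ketBra, Matrix.vecMulVec_apply]
  · obtain ⟨r, hr, hu, h⟩ := exists_isUnitVec_smul hx
    exact ⟨r ^ 2, _, by positivity, hu, h⟩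

lemma ketBra_tensorVec {I J : Type*} (x : I → ℂ) (y : J → ℂ) :
    ketBra (tensorVec x y) = ketBra x ⊗ₖ ketBra y := by
  ext ⟨i, j⟩ ⟨i', j'⟩
  simp [ketBra, tensorVec, Matrix.vecMulVec_apply]
  ring

lemma trace_ketBra {I : Type*} [Fintype I] (x : I → ℂ) : (ketBra x).trace = star x ⬝ᵥ x := by
  rw [ketBra, Matrix.trace_vecMulVec, dotProduct_comm]

/-- Normalizing the factors moves their squared norms into the weights, and the trace condition
makes the weights sum to 1. -/
lemma isSeparableState_of_sum {A C ι : Type*} [Fintype A] [Fintype C] [Fintype ι]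
    {ρ : Matrix (A × C) (A × C) ℂ} (x : ι → A → ℂ) (y : ι → C → ℂ)
    (h : ρ = ∑ n, ketBra (tensorVec (x n) (y n))) (htr : ρ.trace = 1) : IsSeparableState ρ := by
  have hne : Nonempty (A × C) := by
    by_contra hne
    rw [not_nonempty_iff] at hne
    simp [Matrix.trace] at htr
  have : Nonempty A := hne.map Prod.fst
  have : Nonempty C := hne.map Prod.snd
  choose q u hq hu hqu using fun n => exists_ketBra_eq_smul (x n)
  choose q' v hq' hv hqv using fun n => exists_ketBra_eq_smul (y n)
  let e := Fintype.equivFin ι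
  have hρ : ρ = ∑ n, ((q n * q' n : ℝ) : ℂ) • (ketBra (u n) ⊗ₖ ketBra (v n)) := by
    rw [h]
    refine Finset.sum_congr rfl fun n _ => ?_
    rw [ketBra_tensorVec, hqu, hqv, Matrix.smul_kronecker, Matrix.kronecker_smul, smul_smul,
      Complex.ofReal_mul]
  refine ⟨Fintype.card ι, fun n => q (e.symm n) * q' (e.symm n), fun n => u (e.symm n),
    fun n => v (e.symm n), fun n => mul_nonneg (hq _) (hq' _), ?_, fun n => hu _, fun n => hv _, ?_⟩
  · rw [Equiv.sum_comp e.symm (fun n => q n * q' n)]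
    rw [hρ, Matrix.trace_sum] at htr
    simp only [Matrix.trace_smul, Matrix.trace_kronecker, trace_ketBra] at htr
    have : ∀ n, star (u n) ⬝ᵥ u n = 1 := hu
    have : ∀ n, star (v n) ⬝ᵥ v n = 1 := hv
    simp only [*, mul_one, smul_eq_mul] at htr
    exact_mod_cast htr
  · rw [Equiv.sum_comp e.symm (fun n => ((q n * q' n : ℝ) : ℂ) • (ketBra (u n) ⊗ₖ ketBra (v n)))]
    exact hρ

/-! ### Product resolutions imply the entanglement-breaking property. -/

/-- There are vectors `t_n` (the columns of `t`) resolving the identity of the second factor such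
that contracting `V` with each `t_n` gives at most one direction of the first factor. -/
def HasProductResolution {A B : Type*} [Fintype B] [DecidableEq B]
    (V : Submodule ℂ (A × B → ℂ)) : Prop :=
  ∃ (ι : Type) (_ : Fintype ι) (t : Matrix B ι ℂ), t * tᴴ = 1 ∧
    ∀ n, ∃ a : A → ℂ, ∀ v ∈ V, ∃ c : ℂ, ∀ i, ∑ b, v (i, b) * t b n = c * a i

/-- The direction `a` is common to all of `V`, so contractions of elementary tensors `v ⊗ w` lie in
`a ⊗ ℂ^J`, which is closed under linear combinations. -/
lemma exists_contraction_eq_tensorVec {A B J : Type*} [Fintype B]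
    {V : Submodule ℂ (A × B → ℂ)} {s : B → ℂ} {a : A → ℂ}
    (h : ∀ v ∈ V, ∃ c : ℂ, ∀ i, ∑ b, v (i, b) * s b = c * a i)
    {Ψ : (A × B) × J → ℂ} (hΨ : Ψ ∈ tensorFull V J) :
    ∃ w : J → ℂ, (fun x : A × J => ∑ b, Ψ ((x.1, b), x.2) * s b) = tensorVec a w := by
  induction hΨ using Submodule.span_induction with
  | mem Φ hΦ =>
    obtain ⟨v, hv, w, rfl⟩ := hΦ
    obtain ⟨c, hc⟩ := h v hv
    refine ⟨c • w, ?_⟩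
    ext ⟨i, j⟩
    have := congrArg (· * w j) (hc i)
    simp only [Finset.sum_mul] at this
    simp only [tensorVec, Pi.smul_apply, smul_eq_mul]
    rw [show a i * (c * w j) = c * a i * w j by ring, ← this]
    exact Finset.sum_congr rfl fun _ _ => by ring
  | zero => exact ⟨0, by ext; simp [tensorVec]⟩
  | add Φ Φ' _ _ ih ih' =>
    obtain ⟨w, hw⟩ := ih
    obtain ⟨w', hw'⟩ := ih'
    refine ⟨w + w', ?_⟩
    ext x
    have := congrFun hw x
    have := congrFun hw' x
    simp only [tensorVec, Pi.add_apply, add_mul, Finset.sum_add_distrib, mul_add] at *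
    simp [*]
  | smul c Φ _ ih =>
    obtain ⟨w, hw⟩ := ih
    refine ⟨c • w, ?_⟩
    ext x
    have := congrFun hw x
    simp only [tensorVec, Pi.smul_apply, smul_eq_mul, mul_assoc, ← Finset.mul_sum] at *
    rw [this]
    ring

/-- A partial trace may be computed with any resolution of the identity in place of an orthonormal
basis. -/
lemma partialTraceB_ketBra_eq_sum {A B J ι : Type*} [Fintype B] [DecidableEq B] [Fintype ι]
    {t : Matrix B ι ℂ} (ht : t * tᴴ = 1) (Ψ : (A × B) × J → ℂ) :
    partialTraceB (ketBra Ψ) =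
      ∑ n, ketBra (fun x : A × J => ∑ b, Ψ ((x.1, b), x.2) * t b n) := by
  ext x y
  have hb : ∀ b b', ∑ n, t b n * star (t b' n) = if b = b' then 1 else 0 := by
    intro b b'
    have := congrFun (congrFun ht b) b'
    rwa [Matrix.mul_apply, Matrix.one_apply] at this
  rw [Matrix.sum_apply]
  simp only [partialTraceB, ketBra, Matrix.vecMulVec_apply, Pi.star_apply, star_sum,
    Finset.sum_mul_sum, star_mul']
  rw [Finset.sum_comm]
  refine Finset.sum_congr rfl fun b _ => ?_
  rw [Finset.sum_comm, Finset.sum_eq_single b]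
  · have : ∀ n, Ψ ((x.1, b), x.2) * t b n * (star (Ψ ((y.1, b), y.2)) * star (t b n)) =
        Ψ ((x.1, b), x.2) * star (Ψ ((y.1, b), y.2)) * (t b n * star (t b n)) := fun n => by ring
    simp only [this, ← Finset.mul_sum, hb, if_true, mul_one]
  · intro b' _ hbb
    have : ∀ n, Ψ ((x.1, b), x.2) * t b n * (star (Ψ ((y.1, b'), y.2)) * star (t b' n)) =
        Ψ ((x.1, b), x.2) * star (Ψ ((y.1, b'), y.2)) * (t b n * star (t b' n)) :=
      fun n => by ring
    simp only [this, ← Finset.mul_sum, hb, if_neg (Ne.symm hbb), mul_zero]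
  · simp

lemma trace_partialTraceB_ketBra {A B J : Type*} [Fintype A] [Fintype B] [Fintype J]
    (Ψ : (A × B) × J → ℂ) : (partialTraceB (ketBra Ψ)).trace = star Ψ ⬝ᵥ Ψ := by
  rw [← trace_ketBra]
  simp only [Matrix.trace, Matrix.diag_apply, partialTraceB, Fintype.sum_prod_type]
  exact Finset.sum_congr rfl fun _ _ => Finset.sum_comm

lemma HasProductResolution.isEBSpace {A B : Type*} [Fintype A] [Fintype B] [DecidableEq B]
    {V : Submodule ℂ (A × B → ℂ)} (h : HasProductResolution V) : IsEBSpace V := by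
  obtain ⟨ι, _, t, ht, hV⟩ := h
  intro p q Ψ hΨ hunit
  choose a ha using hV
  choose w hw using fun n => exists_contraction_eq_tensorVec (ha n) hΨ
  refine isSeparableState_of_sum a w ?_ ?_
  · rw [partialTraceB_ketBra_eq_sum ht]
    simp only [hw]
  · rw [trace_partialTraceB_ketBra]
    exact hunit

lemma HasProductResolution.of_ebConvertible {A A' B : Type*} [Fintype A] [Fintype B]
    [DecidableEq B] {V : Submodule ℂ (A × B → ℂ)} {V' : Submodule ℂ (A' × B → ℂ)}
    (h : HasProductResolution V) (hVV : EBConvertible V V') : HasProductResolution V' := by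
  obtain ⟨ι, _, t, ht, hV⟩ := h
  obtain ⟨W, U, hU, rfl⟩ := hVV
  rw [Matrix.mem_unitaryGroup_iff', Matrix.star_eq_conjTranspose] at hU
  have hU' : Uᵀ * Uᴴᵀ = 1 := by rw [← Matrix.transpose_mul, hU, Matrix.transpose_one]
  have hU'' : Uᴴᵀ * Uᵀ = 1 := mul_eq_one_comm.mp hU'
  have hc : (Uᴴᵀ)ᴴ = Uᵀ := by ext; simp
  -- Coefficient matrices transform as `M ↦ W M Uᵀ`, so the frame is moved by the inverse of `Uᵀ`,
  -- the entrywise conjugate of `U`.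
  refine ⟨ι, ‹_›, Uᴴᵀ * t, ?_, fun n => ?_⟩
  · rw [Matrix.conjTranspose_mul, hc, Matrix.mul_assoc, ← Matrix.mul_assoc t, ht, Matrix.one_mul,
      hU'']
  · obtain ⟨a, ha⟩ := hV n
    refine ⟨W *ᵥ a, ?_⟩
    rintro _ ⟨v, hv, rfl⟩
    obtain ⟨c, hc⟩ := ha v hv
    refine ⟨c, fun i => ?_⟩
    have h1 : v = vecOf (Matrix.of fun i b => v (i, b)) := rfl
    set M : Matrix A B ℂ := Matrix.of fun i b => v (i, b) with hMdef
    have h2 : (M * t).col n = c • a := by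
      ext i
      simpa [Matrix.mul_apply, hMdef] using hc i
    rw [Matrix.mulVecLin_apply, h1, kronecker_mulVec_vecOf]
    have h3 : W * M * Uᵀ * (Uᴴᵀ * t) = W * (M * t) := by
      rw [Matrix.mul_assoc, ← Matrix.mul_assoc Uᵀ, hU', Matrix.one_mul, Matrix.mul_assoc]
    have h4 := congrFun (congrFun h3 i) n
    rw [Matrix.mul_apply] at h4
    refine h4.trans ?_
    have h5 : (W * (M * t)) i n = (W *ᵥ (M * t).col n) i := rfl
    rw [h5, h2, Matrix.mulVec_smul]
    rfl

lemma hasProductResolution_span_pair {A B : Type*} [Fintype B] [DecidableEq B]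
    {M N : Matrix A B ℂ} {ι : Type} [Fintype ι] (t : Matrix B ι ℂ) (ht : t * tᴴ = 1)
    (h : ∀ n, ∃ (a : A → ℂ) (c c' : ℂ), (M * t).col n = c • a ∧ (N * t).col n = c' • a) :
    HasProductResolution (Submodule.span ℂ {vecOf M, vecOf N}) := by
  refine ⟨ι, ‹_›, t, ht, fun n => ?_⟩
  obtain ⟨a, c, c', h, h'⟩ := h n
  refine ⟨a, fun v hv => ?_⟩
  obtain ⟨x, y, rfl⟩ := Submodule.mem_span_pair.mp hv
  refine ⟨x * c + y * c', fun i => ?_⟩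
  have e := congrFun h i
  have e' := congrFun h' i
  simp only [Matrix.col_apply, Matrix.mul_apply, Pi.smul_apply, smul_eq_mul] at e e'
  simp only [Pi.add_apply, Pi.smul_apply, smul_eq_mul, vecOf, add_mul, Finset.sum_add_distrib,
    mul_assoc, ← Finset.mul_sum, e, e']

lemma hasProductResolution_diagonal (c c' : Fin 3 → ℂ) : HasProductResolution
    (Submodule.span ℂ {vecOf (Matrix.diagonal c), vecOf (Matrix.diagonal c')}) := by
  refine hasProductResolution_span_pair (1 : Matrix (Fin 3) (Fin 3) ℂ) (by simp) fun n =>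
    ⟨Pi.single n 1, c n, c' n, ?_, ?_⟩ <;>
  · ext i
    by_cases h : i = n
    · subst h; simp
    · simp [h]

/-! ### An explicit resolution for the two-qubit model. -/

lemma exists_pos_sq_eq_one_add_mul (α : ℝ) : ∃ s : ℝ, 0 < s ∧ s ^ 2 = 1 + α * s := by
  have h : 0 ≤ α ^ 2 + 4 := by positivity
  refine ⟨(α + √(α ^ 2 + 4)) / 2, ?_, ?_⟩
  · have : |α| < √(α ^ 2 + 4) := by
      rw [← Real.sqrt_sq_eq_abs]
      exact Real.sqrt_lt_sqrt (sq_nonneg α) (by linarith)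
    linarith [neg_abs_le α]
  · nlinarith [Real.sq_sqrt h]

/-- The two-qubit separability inequality, solved for the squared norm of the last coordinate of a
product resolution supported on the two coordinate axes. -/
lemma exists_axis_parameters {d g x y : ℝ} (hd : 0 ≤ d) (hg : 0 < g)
    (h : 0 ≤ -1 - (x ^ 2 + y ^ 2) + g ^ 2 - d ^ 2 * (-2 + d ^ 2 + (x ^ 2 + y ^ 2) + g ^ 2)
      + 2 * d * (x ^ 2 - y ^ 2)) :
    d ≤ 1 ∧ ∃ α β : ℝ, α * (1 + d) = 2 * x ∧ β * (1 - d) = 2 * y ∧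
      (1 - d ^ 2) + (1 + d) / 2 * ((α - x) ^ 2 + y ^ 2)
        + (1 - d) / 2 * ((β - y) ^ 2 + x ^ 2) ≤ g ^ 2 := by
  have h' : 0 ≤ (1 - d ^ 2) * (d ^ 2 + g ^ 2 - 1) - (1 - d) ^ 2 * x ^ 2 - (1 + d) ^ 2 * y ^ 2 := by
    linarith
  -- For `d > 1` the product `(1 - d²)(d² + g² - 1)` is negative, against `h'`.
  have hd1 : d ≤ 1 := by
    by_contra hlt
    push Not at hlt
    have h1 : 0 < d ^ 2 - 1 := by nlinarith
    have h2 : 0 < (d ^ 2 - 1) * (d ^ 2 + g ^ 2 - 1) := mul_pos h1 (by nlinarith [sq_pos_of_pos hg])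
    nlinarith [mul_nonneg (sq_nonneg (1 - d)) (sq_nonneg x),
      mul_nonneg (sq_nonneg (1 + d)) (sq_nonneg y)]
  refine ⟨hd1, ?_⟩
  have hp : (1 + d) ≠ 0 := by positivity
  -- At `d = 1` the inequality forces `y = 0`, and `β` is unconstrained, its weight `(1 - d) / 2`
  -- being zero.
  rcases hd1.eq_or_lt with rfl | hlt
  · have hy : y = 0 := by
      have : y ^ 2 ≤ 0 := by linarith
      exact pow_eq_zero_iff two_ne_zero |>.mp (le_antisymm this (sq_nonneg y))
    refine ⟨x, 0, by ring, by simp [hy], ?_⟩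
    simp [hy]
    positivity
  · have hm : 0 < 1 - d := by linarith
    refine ⟨2 * x / (1 + d), 2 * y / (1 - d), by field_simp, by field_simp, ?_⟩
    have key : (1 - d ^ 2) * ((1 - d ^ 2) + (1 + d) / 2 * ((2 * x / (1 + d) - x) ^ 2 + y ^ 2)
        + (1 - d) / 2 * ((2 * y / (1 - d) - y) ^ 2 + x ^ 2)) =
        (1 - d ^ 2) ^ 2 + (1 - d) ^ 2 * x ^ 2 + (1 + d) ^ 2 * y ^ 2 := by
      field_simp
      ring
    have hpos : 0 < 1 - d ^ 2 := by nlinarith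
    refine le_of_mul_le_mul_left ?_ hpos
    rw [key]
    linarith

/-- For every `λ`, the vector `(1, λ, (λ² - z λ - d) / g)` is a generalized eigenvector with
eigenvalue `λ`. The frame uses scaled vectors with `λ = s, -1/s` on the real axis and `λ = i r,
-i/r` on the imaginary axis, orthogonal in each pair on the first two coordinates, together with a
multiple of the last basis vector. The relations `s² = 1 + α s` and `r² = 1 + β r` keep the third
coordinates linear in `s` and `r`. -/
lemma hasProductResolution_qubit {d g : ℝ} {z : ℂ} (hd : 0 ≤ d) (hg : 0 < g)
    (h : 0 ≤ -1 - (z.re ^ 2 + z.im ^ 2) + g ^ 2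
      - d ^ 2 * (-2 + d ^ 2 + (z.re ^ 2 + z.im ^ 2) + g ^ 2) + 2 * d * (z.re ^ 2 - z.im ^ 2)) :
    HasProductResolution (Submodule.span ℂ
      {vecOf (!![1, 0, 0; 0, 1, 0; 0, 0, 0] : Matrix (Fin 3) (Fin 3) ℂ),
        vecOf !![0, 1, 0; (d : ℂ), z, g; 0, 0, 0]}) := by
  obtain ⟨hd1, α, β, hα, hβ, hle⟩ := exists_axis_parameters hd hg h
  obtain ⟨s, hs, hsα⟩ := exists_pos_sq_eq_one_add_mul α
  obtain ⟨r, hr, hrβ⟩ := exists_pos_sq_eq_one_add_mul β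
  -- The weights `(1 ± d) / 2` of the two pairs sum to 1 and make the first and third rows of the
  -- frame orthogonal; the equations for `α` and `β` do the same for the second and third.
  obtain ⟨k, hk⟩ : ∃ k : ℝ, k ^ 2 * (s ^ 2 + 1) = (1 + d) / 2 := by
    refine ⟨√((1 + d) / 2 / (s ^ 2 + 1)), ?_⟩
    rw [Real.sq_sqrt (by positivity)]
    field_simp
  obtain ⟨l, hl⟩ : ∃ l : ℝ, l ^ 2 * (r ^ 2 + 1) = (1 - d) / 2 := by
    refine ⟨√((1 - d) / 2 / (r ^ 2 + 1)), ?_⟩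
    rw [Real.sq_sqrt (div_nonneg (by linarith) (by positivity))]
    field_simp
  -- The fifth vector supplies what the third row lacks to have norm 1; the numerical condition says
  -- this amount is nonnegative.
  obtain ⟨q, hq⟩ : ∃ q : ℝ, g ^ 2 * q ^ 2 = g ^ 2 - ((1 - d ^ 2)
      + (1 + d) / 2 * ((α - z.re) ^ 2 + z.im ^ 2)
      + (1 - d) / 2 * ((β - z.im) ^ 2 + z.re ^ 2)) := by
    refine ⟨√((g ^ 2 - ((1 - d ^ 2)
      + (1 + d) / 2 * ((α - z.re) ^ 2 + z.im ^ 2)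
      + (1 - d) / 2 * ((β - z.im) ^ 2 + z.re ^ 2))) / g ^ 2), ?_⟩
    rw [Real.sq_sqrt (div_nonneg (by linarith) (by positivity))]
    field_simp
  have hg0 : (g : ℂ) ≠ 0 := by exact_mod_cast hg.ne'
  have hs0 : (s : ℂ) ≠ 0 := by exact_mod_cast hs.ne'
  have hr0 : (r : ℂ) ≠ 0 := by exact_mod_cast hr.ne'
  obtain ⟨x, y, rfl⟩ : ∃ x y : ℝ, z = x + y * Complex.I := ⟨z.re, z.im, (Complex.re_add_im z).symm⟩
  simp only [Complex.add_re, Complex.ofReal_re, Complex.mul_re, Complex.I_re, mul_zero,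
    Complex.ofReal_im, Complex.I_im, mul_one, sub_self, add_zero, Complex.add_im, Complex.mul_im,
    zero_add] at hα hβ hq
  have cα : (α : ℂ) * (1 + d) = 2 * x := by exact_mod_cast hα
  have cβ : (β : ℂ) * (1 - d) = 2 * y := by exact_mod_cast hβ
  have cs : (s : ℂ) ^ 2 = 1 + α * s := by exact_mod_cast hsα
  have cr : (r : ℂ) ^ 2 = 1 + β * r := by exact_mod_cast hrβ
  have ck : (k : ℂ) ^ 2 * (s ^ 2 + 1) = (1 + d) / 2 := by exact_mod_cast hk
  have cl : (l : ℂ) ^ 2 * (r ^ 2 + 1) = (1 - d) / 2 := by exact_mod_cast hl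
  have cq : (g : ℂ) ^ 2 * q ^ 2 = g ^ 2 - ((1 - d ^ 2)
      + (1 + d) / 2 * ((α - x) ^ 2 + y ^ 2) + (1 - d) / 2 * ((β - y) ^ 2 + x ^ 2)) := by
    exact_mod_cast hq
  have hI : Complex.I ^ 2 = -1 := Complex.I_sq
  let t : Matrix (Fin 3) (Fin 5) ℂ :=
    !![(k : ℂ), k * s, l, l * r, 0;
      k * s, -k, l * (Complex.I * r), -(l * Complex.I), 0;
      k * (((1 - d) + (α - (x + y * Complex.I)) * s) / g),
      k * (((1 - d) * s - (α - (x + y * Complex.I))) / g),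
      l * ((-(1 + d) + (-β - Complex.I * (x + y * Complex.I)) * r) / g),
      l * ((-(1 + d) * r - (-β - Complex.I * (x + y * Complex.I))) / g), q]
  refine hasProductResolution_span_pair t ?_ fun n => ?_
  · ext i j
    fin_cases i <;> fin_cases j <;>
      simp [t, Matrix.mul_apply, Fin.sum_univ_five]
    · linear_combination ck + cl
    · ring
    · field_simp
      linear_combination (1 - (d : ℂ)) * ck - (1 + d) * cl
    · ring
    · linear_combination ck + cl - l ^ 2 * (r ^ 2 + 1) * hI
    · field_simp
      linear_combination (α - x + Complex.I * y) * ck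
        + Complex.I * (-β + Complex.I * x - Complex.I ^ 2 * y) * cl + cα / 2
        - Complex.I / 2 * cβ + (1 - d) / 2 * (x - Complex.I * y) * hI
    · field_simp
      linear_combination (1 - (d : ℂ)) * ck - (1 + d) * cl
    · field_simp
      linear_combination (α - x - Complex.I * y) * ck
        - Complex.I * (-β - Complex.I * x - Complex.I ^ 2 * y) * cl + cα / 2
        + Complex.I / 2 * cβ + (1 - d) / 2 * (x + Complex.I * y) * hI
    · field_simp
      linear_combination ((1 - d) ^ 2 + (α - x - Complex.I * y) * (α - x + Complex.I * y)) * ck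
        + ((1 + d) ^ 2 + (-β - Complex.I * x - Complex.I ^ 2 * y)
          * (-β + Complex.I * x - Complex.I ^ 2 * y)) * cl + cq
        + (-(1 + d) / 2 * y ^ 2 + (1 - d) / 2 * (y * (2 * β + Complex.I ^ 2 * y - y) - x ^ 2)) * hI
  · fin_cases n
    · refine ⟨![k, k * s, 0], 1, s, ?_, ?_⟩ <;> ext i <;> fin_cases i <;>
        simp [t]
      · ring
      · field_simp
        linear_combination (-k) * cs
    · refine ⟨![k * s, -k, 0], 1, -(s : ℂ)⁻¹, ?_, ?_⟩ <;> ext i <;> fin_cases i <;>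
        simp [t]
      · field_simp
      · field_simp
        linear_combination k * cs
    · refine ⟨![l, l * (Complex.I * r), 0], 1, Complex.I * r, ?_, ?_⟩ <;> ext i <;>
        fin_cases i <;> simp [t]
      · ring
      · field_simp
        linear_combination l * cr - l * r ^ 2 * hI
    · refine ⟨![l * r, -(l * Complex.I), 0], 1, -(Complex.I * (r : ℂ)⁻¹), ?_, ?_⟩ <;> ext i <;>
        fin_cases i <;> simp [t]
      · field_simp
      · field_simp
        linear_combination (-l) * cr - l * hI
    · refine ⟨![0, 1, 0], 0, g * q, ?_, ?_⟩ <;> ext i <;> fin_cases i <;>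
        simp [t]

/-! ### From separability to a product resolution. -/

open scoped ComplexOrder in
/-- Two factorizations `Φ Φᴴ = P Pᴴ` differ by a coisometry, after padding `P` with zero columns. -/
lemma exists_coisometry_of_mul_conjTranspose_eq {I J ι : Type*} [Fintype I] [Fintype J]
    [DecidableEq J] [Fintype ι] (Φ : Matrix I J ℂ) (P : Matrix I ι ℂ) (h : Φ * Φᴴ = P * Pᴴ) :
    ∃ T : Matrix J (ι ⊕ J) ℂ, T * Tᴴ = 1 ∧ Φ * T = Matrix.fromCols P 0 := by
  classical
  have hG := Matrix.isHermitian_conjTranspose_mul_self Φ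
  set U : Matrix J J ℂ := hG.eigenvectorUnitary.1 with hUdef
  set d : J → ℂ := RCLike.ofReal ∘ hG.eigenvalues with hd
  have hU1 : U * Uᴴ = 1 := by
    rw [← Matrix.star_eq_conjTranspose]; exact Unitary.coe_mul_star_self _
  have hU2 : Uᴴ * U = 1 := mul_eq_one_comm.mp hU1
  set F := Φ * U with hF
  have hFF : Fᴴ * F = Matrix.diagonal d := by
    have := hG.conjStarAlgAut_star_eigenvectorUnitary
    rw [Unitary.conjStarAlgAut_star_apply] at this
    rw [← this, hF, Matrix.conjTranspose_mul, ← Matrix.star_eq_conjTranspose]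
    simp only [Matrix.mul_assoc]
    rfl
  have hdstar : ∀ i, star (d i) = d i := fun i => by simp [hd]
  have hPF : F * Fᴴ = P * Pᴴ := by
    rw [← h, hF, Matrix.conjTranspose_mul, Matrix.mul_assoc, ← Matrix.mul_assoc U, hU1,
      Matrix.one_mul]
  clear_value F
  -- Since `0⁻¹ = 0`, `D'` is the pseudo-inverse of `Fᴴ F`, and `E` projects onto its kernel. The
  -- coisometry is `U` times the block row `[D' Fᴴ P, E]`.
  set D' : Matrix J J ℂ := Matrix.diagonal fun i => (d i)⁻¹ with hD'
  set E : Matrix J J ℂ := Matrix.diagonal fun i => if d i = 0 then 1 else 0 with hE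
  have hDE : D' * Matrix.diagonal d + E * E = 1 := by
    rw [hD', hE, Matrix.diagonal_mul_diagonal, Matrix.diagonal_mul_diagonal, Matrix.diagonal_add,
      ← Matrix.diagonal_one]
    congr 1
    ext i
    by_cases hi : d i = 0 <;> simp [hi]
  have hDherm : D'ᴴ = D' := by
    rw [hD', Matrix.diagonal_conjTranspose]
    congr 1
    ext i
    simp [hdstar]
  have hEherm : Eᴴ = E := by
    rw [hE, Matrix.diagonal_conjTranspose]
    congr 1
    ext i
    by_cases hi : d i = 0 <;> simp [hi]
  clear_value d
  have hFE : F * E = 0 := by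
    rw [← Matrix.conjTranspose_mul_self_eq_zero, Matrix.conjTranspose_mul, Matrix.mul_assoc,
      ← Matrix.mul_assoc Fᴴ, hFF, hEherm, hE, Matrix.diagonal_mul_diagonal,
      Matrix.diagonal_mul_diagonal]
    rw [← Matrix.diagonal_zero]
    congr 1
    ext i
    by_cases hi : d i = 0 <;> simp [hi]
  have hFP : F * (D' * (Fᴴ * P)) = P := by
    have hRF : (1 - F * D' * Fᴴ) * F = 0 := by
      have : F * D' * Fᴴ * F = F * (D' * Matrix.diagonal d) := by
        rw [Matrix.mul_assoc, hFF, Matrix.mul_assoc]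
      rw [Matrix.sub_mul, Matrix.one_mul, this, eq_sub_of_add_eq hDE, Matrix.mul_sub,
        Matrix.mul_one, ← Matrix.mul_assoc, hFE, Matrix.zero_mul, sub_zero, sub_self]
    -- `P` has the same Gram matrix `P Pᴴ = F Fᴴ` as `F`, so whatever annihilates `F` from the left
    -- annihilates `P`.
    have hRP : (1 - F * D' * Fᴴ) * P = 0 := by
      generalize 1 - F * D' * Fᴴ = R at hRF ⊢
      have : R * P * (R * P)ᴴ = R * F * Fᴴ * Rᴴ := by
        rw [Matrix.conjTranspose_mul, Matrix.mul_assoc, ← Matrix.mul_assoc P, ← hPF,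
          Matrix.mul_assoc R F, Matrix.mul_assoc R]
      rw [← Matrix.self_mul_conjTranspose_eq_zero, this, hRF, Matrix.zero_mul, Matrix.zero_mul]
    rw [Matrix.sub_mul, Matrix.one_mul, sub_eq_zero] at hRP
    rw [← Matrix.mul_assoc, ← Matrix.mul_assoc, ← hRP]
  refine ⟨U * Matrix.fromCols (D' * (Fᴴ * P)) E, ?_, ?_⟩
  · rw [Matrix.conjTranspose_mul, Matrix.mul_assoc, ← Matrix.mul_assoc (Matrix.fromCols _ _),
      Matrix.conjTranspose_fromCols_eq_fromRows_conjTranspose, Matrix.fromCols_mul_fromRows]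
    have : D' * (Fᴴ * P) * (D' * (Fᴴ * P))ᴴ = D' * Matrix.diagonal d := by
      have h1 : D' * (Fᴴ * P) * (D' * (Fᴴ * P))ᴴ = D' * (Fᴴ * F) * ((Fᴴ * F) * D') := by
        rw [Matrix.conjTranspose_mul, Matrix.conjTranspose_mul, Matrix.conjTranspose_conjTranspose,
          hDherm]
        simp only [Matrix.mul_assoc]
        rw [← Matrix.mul_assoc P, ← hPF]
        simp only [Matrix.mul_assoc]
      rw [h1, hFF, hD', Matrix.diagonal_mul_diagonal, Matrix.diagonal_mul_diagonal,
        Matrix.diagonal_mul_diagonal]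
      congr 1
      ext i
      by_cases hi : d i = 0 <;> simp [hi]
    rw [this, hEherm, hDE, Matrix.one_mul, hU1]
  · rw [← Matrix.mul_assoc, ← hF, Matrix.mul_fromCols, hFP, hFE]

lemma partialTraceB_ketBra_eq_mul {A B C : Type*} [Fintype B] (Ψ : (A × B) × C → ℂ) :
    partialTraceB (ketBra Ψ) =
      (Matrix.of fun (x : A × C) b => Ψ ((x.1, b), x.2)) *
        (Matrix.of fun (x : A × C) b => Ψ ((x.1, b), x.2))ᴴ := by
  ext x y
  simp [partialTraceB, ketBra, Matrix.mul_apply, Matrix.vecMulVec_apply]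

/-- The columns of `T` resolve the identity and each of them is sent by `M` and `N` to parallel
vectors. -/
def IsProductResolution {A B ι : Type*} [Fintype B] [DecidableEq B] [Fintype ι]
    (M N : Matrix A B ℂ) (T : Matrix B ι ℂ) : Prop :=
  T * Tᴴ = 1 ∧ ∀ n, ∃ (a : A → ℂ) (c c' : ℂ), (M * T).col n = c • a ∧ (N * T).col n = c' • a

/-- One test vector suffices: `M ⊗ e₀ + N ⊗ e₁`, normalized, with `a` a qubit and `b` trivial.
Contracting it with a column of the coisometry gives a product vector `u ⊗ v` up to a scalar, and
its two slices are the images of that column under `M` and `N`. The padding columns are sent to zero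
by both. -/
lemma IsEBSpace.exists_isProductResolution {A B : Type*} [Fintype A] [Fintype B] [DecidableEq B]
    {V : Submodule ℂ (A × B → ℂ)} (hV : IsEBSpace V) {M N : Matrix A B ℂ}
    (hM : vecOf M ∈ V) (hN : vecOf N ∈ V) (hM0 : M ≠ 0) :
    ∃ (n : ℕ) (T : Matrix B (Fin n ⊕ B) ℂ), IsProductResolution M N T := by
  classical
  let Ψ₀ : (A × B) × (Fin 2 × Fin 1) → ℂ :=
    tensorVec (vecOf M) (Pi.single (0, 0) 1) + tensorVec (vecOf N) (Pi.single (1, 0) 1)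
  have e0 : ∀ i b, Ψ₀ ((i, b), (0, 0)) = M i b := fun i b => by simp [Ψ₀, tensorVec, vecOf]
  have e1 : ∀ i b, Ψ₀ ((i, b), (1, 0)) = N i b := fun i b => by simp [Ψ₀, tensorVec, vecOf]
  have hΨ₀ : Ψ₀ ∈ tensorFull V (Fin 2 × Fin 1) :=
    add_mem (Submodule.subset_span ⟨_, hM, _, rfl⟩) (Submodule.subset_span ⟨_, hN, _, rfl⟩)
  have hne : Ψ₀ ≠ 0 := by
    intro h
    apply hM0
    ext i b
    rw [← e0, h]
    rfl
  obtain ⟨r, hr, hunit, -⟩ := exists_isUnitVec_smul hne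
  obtain ⟨n, q, u, v, hq, -, -, -, hρ⟩ := hV 2 1 _ (Submodule.smul_mem _ _ hΨ₀) hunit
  have hr0 : (r : ℂ) ≠ 0 := by exact_mod_cast hr.ne'
  let P : Matrix (A × (Fin 2 × Fin 1)) (Fin n) ℂ :=
    Matrix.of fun x k => (√(q k) : ℂ) * (u k x.1 * v k x.2)
  have hP : partialTraceB (ketBra (((r⁻¹ : ℝ) : ℂ) • Ψ₀)) = P * Pᴴ := by
    rw [hρ]
    ext x y
    rw [Matrix.sum_apply, Matrix.mul_apply]
    refine Finset.sum_congr rfl fun k _ => ?_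
    have : (q k : ℂ) = √(q k) * √(q k) := by
      rw [← Complex.ofReal_mul, Real.mul_self_sqrt (hq k)]
    simp only [Matrix.smul_apply, Matrix.kroneckerMap_apply, ketBra, Matrix.vecMulVec_apply, P,
      Matrix.conjTranspose_apply, Matrix.of_apply, smul_eq_mul, this, star_mul', Pi.star_apply,
      Complex.star_def, Complex.conj_ofReal]
    ring
  rw [partialTraceB_ketBra_eq_mul] at hP
  obtain ⟨T, hT, hΦT⟩ := exists_coisometry_of_mul_conjTranspose_eq _ _ hP
  have hent : ∀ (i : A) (x : Fin 2 × Fin 1) k, ∑ b, Ψ₀ ((i, b), x) * T b k =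
      r * Matrix.fromCols P 0 (i, x) k := by
    intro i x k
    rw [← hΦT, Matrix.mul_apply, Finset.mul_sum]
    refine Finset.sum_congr rfl fun b _ => ?_
    simp
    field_simp
  refine ⟨n, T, hT, fun k => ?_⟩
  rcases k with k | k
  · refine ⟨u k, r * √(q k) * v k (0, 0), r * √(q k) * v k (1, 0), ?_, ?_⟩
    · ext i
      have := hent i (0, 0) (Sum.inl k)
      simp only [e0, Matrix.fromCols_apply_inl, P, Matrix.of_apply] at this
      simp only [Matrix.col_apply, Matrix.mul_apply, this, Pi.smul_apply, smul_eq_mul]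
      ring
    · ext i
      have := hent i (1, 0) (Sum.inl k)
      simp only [e1, Matrix.fromCols_apply_inl, P, Matrix.of_apply] at this
      simp only [Matrix.col_apply, Matrix.mul_apply, this, Pi.smul_apply, smul_eq_mul]
      ring
  · refine ⟨0, 0, 0, ?_, ?_⟩
    · ext i
      have := hent i (0, 0) (Sum.inr k)
      simp only [e0, Matrix.fromCols_apply_inr] at this
      simpa [Matrix.mul_apply] using this
    · ext i
      have := hent i (1, 0) (Sum.inr k)
      simp only [e1, Matrix.fromCols_apply_inr] at this
      simpa [Matrix.mul_apply] using this

/-- After replacing `M` by a generic combination `M + x N`, the resolution consists of generalized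
eigenvectors of the pencil. -/
lemma IsProductResolution.exists_eigen {A B ι : Type*} [Fintype B] [DecidableEq B] [Fintype ι]
    [DecidableEq ι] {M N : Matrix A B ℂ} {T : Matrix B ι ℂ} (h : IsProductResolution M N T) :
    ∃ (x : ℂ) (l : ι → ℂ), N * T = (M + x • N) * T * Matrix.diagonal l := by
  choose a c c' hc hc' using h.2
  -- Only finitely many `x` make `M + x N` vanish on a column that `N` does not visibly kill, that
  -- is, one with `c' n ≠ 0`.
  obtain ⟨x, hx⟩ := (Set.finite_range fun n => -c n / c' n).infinite_compl.nonempty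
  have hx' : ∀ n, c' n ≠ 0 → c n + x * c' n ≠ 0 := by
    intro n hn h0
    refine hx ⟨n, ?_⟩
    field_simp
    linear_combination -h0
  refine ⟨x, fun n => c' n / (c n + x * c' n), ?_⟩
  ext i n
  have e : (M * T) i n = c n * a n i := congrFun (hc n) i
  have e' : (N * T) i n = c' n * a n i := congrFun (hc' n) i
  rw [Matrix.mul_diagonal, Matrix.add_mul, Matrix.smul_mul, Matrix.add_apply, Matrix.smul_apply, e,
    e', smul_eq_mul]
  by_cases hn : c' n = 0
  · simp [hn]
  · calc c' n * a n i = c' n * a n i * ((c n + x * c' n) / (c n + x * c' n)) := by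
          rw [div_self (hx' n hn), mul_one]
      _ = _ := by ring

/-! ### The partial transpose inequality. -/

open scoped ComplexOrder in
/-- The partial transpose inequality for a pencil with a resolution by generalized eigenvectors. -/
lemma posSemidef_of_resolution {J ι : Type*} [Fintype J] [DecidableEq J] [Fintype ι]
    [DecidableEq ι] {Q Z : Matrix J J ℂ} {T : Matrix J ι ℂ} {l : ι → ℂ} (hQ : Qᴴ = Q)
    (hQZ : Q * Z = Z) (hT : T * Tᴴ = 1) (h : Z * T = Q * T * Matrix.diagonal l) :
    (Z * Zᴴ - (Z * Q)ᴴ * (Z * Q)).PosSemidef := by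
  set L : Matrix ι ι ℂ := Matrix.diagonal l with hL
  have hLL : Lᴴ * L = L * Lᴴ := by
    rw [hL, Matrix.diagonal_conjTranspose, Matrix.diagonal_mul_diagonal,
      Matrix.diagonal_mul_diagonal]
    simp only [mul_comm]
  clear_value L
  have hZ : Q * T * L * Tᴴ = Z := by rw [← h, Matrix.mul_assoc, hT, Matrix.mul_one]
  have hZs : T * Lᴴ * Tᴴ * Q = Zᴴ := by
    rw [← hZ]
    simp only [Matrix.conjTranspose_mul, Matrix.conjTranspose_conjTranspose, hQ, Matrix.mul_assoc]
  have hZsQ : Zᴴ * Q = Zᴴ := by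
    conv_rhs => rw [← hQZ, Matrix.conjTranspose_mul, hQ]
  -- The defect is the Gram matrix of the vectors `conj(l_n) Q t_n - (Z Q)ᴴ t_n`. The square term
  -- uses that `L` commutes with `Lᴴ`; both cross terms and the last term equal `(Z Q)ᴴ (Z Q)`.
  have key : Z * Zᴴ - (Z * Q)ᴴ * (Z * Q) =
      (Q * T * Lᴴ - (Z * Q)ᴴ * T) * (Q * T * Lᴴ - (Z * Q)ᴴ * T)ᴴ := by
    have e1 : Q * T * Lᴴ * (Q * T * Lᴴ)ᴴ = Z * Zᴴ := by
      have e : Z * Zᴴ = (Z * T) * (Z * T)ᴴ := by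
        rw [Matrix.conjTranspose_mul, Matrix.mul_assoc, ← Matrix.mul_assoc T, hT, Matrix.one_mul]
      rw [e, h, Matrix.conjTranspose_mul _ Lᴴ, Matrix.conjTranspose_mul _ L,
        Matrix.conjTranspose_conjTranspose, Matrix.mul_assoc, ← Matrix.mul_assoc Lᴴ, hLL,
        Matrix.mul_assoc _ L, Matrix.mul_assoc L]
    have e2 : Q * T * Lᴴ * ((Z * Q)ᴴ * T)ᴴ = (Z * Q)ᴴ * (Z * Q) := by
      have : Q * T * Lᴴ * ((Z * Q)ᴴ * T)ᴴ = Q * (T * Lᴴ * Tᴴ * Q) * Z * Q := by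
        simp only [Matrix.conjTranspose_mul, Matrix.conjTranspose_conjTranspose, Matrix.mul_assoc]
        rw [← Matrix.mul_assoc Q Z, hQZ]
      rw [this, hZs, Matrix.conjTranspose_mul, hQ]
      simp only [Matrix.mul_assoc]
    have e3 : (Z * Q)ᴴ * T * (Q * T * Lᴴ)ᴴ = (Z * Q)ᴴ * (Z * Q) := by
      have := congrArg Matrix.conjTranspose e2
      rwa [Matrix.conjTranspose_mul, Matrix.conjTranspose_conjTranspose,
        Matrix.conjTranspose_mul (Z * Q)ᴴ (Z * Q), Matrix.conjTranspose_conjTranspose] at this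
    have e4 : (Z * Q)ᴴ * T * ((Z * Q)ᴴ * T)ᴴ = (Z * Q)ᴴ * (Z * Q) := by
      rw [Matrix.conjTranspose_mul _ T, Matrix.conjTranspose_conjTranspose, Matrix.mul_assoc,
        ← Matrix.mul_assoc T, hT, Matrix.one_mul]
    rw [Matrix.conjTranspose_sub, Matrix.mul_sub, Matrix.sub_mul, Matrix.sub_mul, e1, e2, e3, e4]
    abel
  rw [key]
  exact Matrix.posSemidef_self_mul_conjTranspose _

/-! ### Unitary diagonalization of normal 3×3 matrices. -/

lemma exists_unitary_col_eq {n : ℕ} {u : Fin n → ℂ} (hu : IsUnitVec u) (j : Fin n) :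
    ∃ U ∈ Matrix.unitaryGroup (Fin n) ℂ, ∀ i, U i j = u i := by
  let v : Fin n → EuclideanSpace ℂ (Fin n) := fun _ => WithLp.toLp 2 u
  have hv : Orthonormal ℂ (({j} : Set (Fin n)).domRestrict v) := by
    constructor
    · intro i
      have h1 : star u ⬝ᵥ u = 1 := hu
      rw [dotProduct_star_self_eq] at h1
      have h2 : ∑ i, ‖u i‖ ^ 2 = 1 := by exact_mod_cast h1
      simp [v, EuclideanSpace.norm_eq, h2]
    · intro a b hab
      exact absurd (Subsingleton.elim a b) hab
  obtain ⟨b, hb⟩ := hv.exists_orthonormalBasis_extension_of_card_eq (by simp)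
  refine ⟨(EuclideanSpace.basisFun (Fin n) ℂ).toBasis.toMatrix b,
    (EuclideanSpace.basisFun (Fin n) ℂ).toMatrix_orthonormalBasis_mem_unitary b, fun i => ?_⟩
  have := hb j rfl
  simp [Module.Basis.toMatrix_apply, this, v]

lemma exists_unit_eigenvector {J : Type*} [Fintype J] [DecidableEq J] [Nonempty J]
    (Z : Matrix J J ℂ) : ∃ (x : ℂ) (u : J → ℂ), IsUnitVec u ∧ Z *ᵥ u = x • u := by
  obtain ⟨x, hx⟩ := Module.End.exists_eigenvalue (Matrix.toLin' Z)
  obtain ⟨u, hu⟩ := hx.exists_hasEigenvector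
  obtain ⟨r, -, hr, -⟩ := exists_isUnitVec_smul hu.2
  refine ⟨x, _, hr, ?_⟩
  have : Z *ᵥ u = x • u := by simpa using hu.apply_eq_smul
  rw [Matrix.mulVec_smul, this, smul_comm]

/-- For a normal matrix, row `j` and column `j` have the same norm, and they share the diagonal
entry. -/
lemma row_eq_zero_of_col_eq_zero {J : Type*} [Fintype J] [DecidableEq J] {N : Matrix J J ℂ}
    (hN : N * Nᴴ = Nᴴ * N) {j : J} (h : ∀ i, i ≠ j → N i j = 0) :
    ∀ i, i ≠ j → N j i = 0 := by
  have e := congrFun (congrFun hN j) j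
  simp only [Matrix.mul_apply, Matrix.conjTranspose_apply, Complex.star_def] at e
  have hr : ∑ i, (starRingEnd ℂ) (N i j) * N i j = N j j * (starRingEnd ℂ) (N j j) := by
    rw [Finset.sum_eq_single j (fun i _ hi => by simp [h i hi]) (by simp), mul_comm]
  rw [hr, ← Finset.add_sum_erase _ _ (Finset.mem_univ j), add_eq_left] at e
  simp only [Complex.mul_conj] at e
  have e' : ∑ x ∈ Finset.univ.erase j, Complex.normSq (N j x) = 0 := by exact_mod_cast e
  rw [Finset.sum_eq_zero_iff_of_nonneg (fun _ _ => Complex.normSq_nonneg _)] at e'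
  intro i hi
  exact Complex.normSq_eq_zero.mp (e' i (Finset.mem_erase.mpr ⟨hi, Finset.mem_univ _⟩))

/-- The unitary of `ℂ^3` fixing the last basis vector and with first column `(p, q, 0)`. -/
def planeRotation (p q : ℂ) : Matrix (Fin 3) (Fin 3) ℂ :=
  !![p, -star q, 0; q, star p, 0; 0, 0, 1]

lemma planeRotation_mem_unitaryGroup {p q : ℂ} (h : p * star p + q * star q = 1) :
    planeRotation p q ∈ Matrix.unitaryGroup (Fin 3) ℂ := by
  rw [Matrix.mem_unitaryGroup_iff, Matrix.star_eq_conjTranspose]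
  simp only [Complex.star_def] at h
  ext i j
  fin_cases i <;> fin_cases j <;>
    simp [planeRotation, Matrix.mul_apply, Fin.sum_univ_three]
  · linear_combination h
  · ring
  · ring
  · linear_combination h

lemma unitary_conj_normal {J : Type*} [Fintype J] [DecidableEq J] {Z U : Matrix J J ℂ}
    (hZ : Z * Zᴴ = Zᴴ * Z) (hU : U * Uᴴ = 1) :
    (Uᴴ * Z * U) * (Uᴴ * Z * U)ᴴ = (Uᴴ * Z * U)ᴴ * (Uᴴ * Z * U) := by
  have e : (Uᴴ * Z * U)ᴴ = Uᴴ * Zᴴ * U := by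
    simp [Matrix.conjTranspose_mul, Matrix.mul_assoc]
  have h : ∀ X Y : Matrix J J ℂ, (Uᴴ * X * U) * (Uᴴ * Y * U) = Uᴴ * (X * Y) * U := by
    intro X Y
    calc (Uᴴ * X * U) * (Uᴴ * Y * U) = Uᴴ * X * (U * Uᴴ) * Y * U := by
          simp only [Matrix.mul_assoc]
      _ = _ := by rw [hU, Matrix.mul_one, Matrix.mul_assoc Uᴴ]
  rw [e, h, h, hZ]

/-- Deflation: a unit eigenvector placed last splits off a 2×2 block by normality, and an
eigenvector of that block then finishes through a plane rotation. -/
lemma exists_unitary_diagonalization {Z : Matrix (Fin 3) (Fin 3) ℂ} (hZ : Z * Zᴴ = Zᴴ * Z) :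
    ∃ S ∈ Matrix.unitaryGroup (Fin 3) ℂ, ∃ c, Z = S * Matrix.diagonal c * Sᴴ := by
  obtain ⟨x, u, hu, hx⟩ := exists_unit_eigenvector Z
  obtain ⟨U, hU, hUu⟩ := exists_unitary_col_eq hu 2
  have hU1 : U * Uᴴ = 1 := Matrix.mem_unitaryGroup_iff.mp hU
  have hU2 : Uᴴ * U = 1 := mul_eq_one_comm.mp hU1
  set N := Uᴴ * Z * U with hN
  have hNn : N * Nᴴ = Nᴴ * N := unitary_conj_normal hZ hU1
  have hcol : ∀ i, i ≠ 2 → N i 2 = 0 := by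
    intro i hi
    have h1 : (Z * U).col 2 = x • U.col 2 := by
      have : U.col 2 = u := funext hUu
      rw [this, ← hx, ← this]
      rfl
    have h2 : N i 2 = (Uᴴ *ᵥ (Z * U).col 2) i := by rw [hN, Matrix.mul_assoc]; rfl
    have h3 : (Uᴴ *ᵥ U.col 2) i = (Uᴴ * U) i 2 := rfl
    rw [h2, h1, Matrix.mulVec_smul, Pi.smul_apply, h3, hU2, Matrix.one_apply_ne hi, smul_zero]
  have hrow := row_eq_zero_of_col_eq_zero hNn hcol
  obtain ⟨y, v, hv, hy⟩ := exists_unit_eigenvector !![N 0 0, N 0 1; N 1 0, N 1 1]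
  have hv1 : v 0 * star (v 0) + v 1 * star (v 1) = 1 := by
    have : star v ⬝ᵥ v = 1 := hv
    simp only [dotProduct, Fin.sum_univ_two, Pi.star_apply] at this
    linear_combination this
  have hy0 : N 0 0 * v 0 + N 0 1 * v 1 = y * v 0 := by
    simpa [Matrix.mulVec, dotProduct, Fin.sum_univ_two] using congrFun hy 0
  have hy1 : N 1 0 * v 0 + N 1 1 * v 1 = y * v 1 := by
    simpa [Matrix.mulVec, dotProduct, Fin.sum_univ_two] using congrFun hy 1
  have hR := planeRotation_mem_unitaryGroup hv1
  set R := planeRotation (v 0) (v 1) with hRdef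
  have hR1 : R * Rᴴ = 1 := Matrix.mem_unitaryGroup_iff.mp hR
  have n02 := hcol 0 (by decide)
  have n12 := hcol 1 (by decide)
  have n20 := hrow 0 (by decide)
  have n21 := hrow 1 (by decide)
  clear_value N
  have hDn : (Rᴴ * N * R) * (Rᴴ * N * R)ᴴ = (Rᴴ * N * R)ᴴ * (Rᴴ * N * R) :=
    unitary_conj_normal hNn hR1
  have hD : ∀ i, i ≠ 0 → (Rᴴ * N * R) i 0 = 0 := by
    intro i hi
    rw [Matrix.mul_assoc]
    fin_cases i
    · exact absurd rfl hi
    · simp [Matrix.mul_apply, Fin.sum_univ_three, hRdef, planeRotation, n20, n21]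
      linear_combination -v 1 * hy0 + v 0 * hy1
    · simp [Matrix.mul_apply, Fin.sum_univ_three, hRdef, planeRotation, n20, n21]
  have hD' := row_eq_zero_of_col_eq_zero hDn hD
  have d02 : (Rᴴ * N * R) 0 2 = 0 := hD' 2 (by decide)
  have d01 : (Rᴴ * N * R) 0 1 = 0 := hD' 1 (by decide)
  have d12 : (Rᴴ * N * R) 1 2 = 0 := by
    rw [Matrix.mul_assoc]
    simp [Matrix.mul_apply, Fin.sum_univ_three, hRdef, planeRotation, n02, n12]
  have d21 : (Rᴴ * N * R) 2 1 = 0 := by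
    rw [Matrix.mul_assoc]
    simp [Matrix.mul_apply, Fin.sum_univ_three, hRdef, planeRotation, n20, n21]
  have hdiag : Rᴴ * N * R = Matrix.diagonal fun i => (Rᴴ * N * R) i i := by
    generalize Rᴴ * N * R = D at *
    ext i j
    fin_cases i <;> fin_cases j <;>
      simp [d01, d02, d12, d21, hD 1 (by decide), hD 2 (by decide)]
  refine ⟨U * R, mul_mem hU hR, fun i => (Rᴴ * N * R) i i, ?_⟩
  rw [← hdiag, hN, Matrix.conjTranspose_mul]
  calc Z = (U * Uᴴ) * Z * (U * Uᴴ) := by rw [hU1, Matrix.one_mul, Matrix.mul_one]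
    _ = U * (R * Rᴴ) * (Uᴴ * Z * U) * (R * Rᴴ) * Uᴴ := by
        rw [hR1, Matrix.mul_one, Matrix.mul_one]; simp only [Matrix.mul_assoc]
    _ = _ := by simp only [Matrix.mul_assoc]

open scoped ComplexOrder in
-- A commutator has trace zero, and a positive semidefinite matrix of trace zero vanishes.
lemma normal_of_posSemidef {J : Type*} [Fintype J] {Z : Matrix J J ℂ}
    (h : (Z * Zᴴ - Zᴴ * Z).PosSemidef) : Z * Zᴴ = Zᴴ * Z := by
  rw [← sub_eq_zero]
  refine h.trace_eq_zero_iff.mp ?_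
  rw [Matrix.trace_sub, Matrix.trace_mul_comm, sub_self]

lemma mul_mul_mul_of_mul_eq_one {I J K : Type*} [Fintype J] [DecidableEq J] {R S : Matrix J J ℂ}
    (h : R * S = 1) (W : Matrix I J ℂ) (X : Matrix J K ℂ) : W * R * (S * X) = W * X := by
  rw [Matrix.mul_assoc, ← Matrix.mul_assoc R, h, Matrix.one_mul]

/-! ### Pencils: admissible changes and the diagonal cases. -/

/-- `V` is the plane spanned by `W U` and `W Z U`, where `U` is unitary, and the columns of `T` form
a resolution of the identity by generalized eigenvectors of the pencil `(W, W Z)`. -/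
structure IsPencil {I ι : Type*} [Fintype ι] [DecidableEq ι] (V : Submodule ℂ (I × Fin 3 → ℂ))
    (W : Matrix I (Fin 3) ℂ) (Z U : Matrix (Fin 3) (Fin 3) ℂ) (T : Matrix (Fin 3) ι ℂ)
    (l : ι → ℂ) : Prop where
  unitary : U ∈ Matrix.unitaryGroup (Fin 3) ℂ
  span : V = Submodule.span ℂ {vecOf (W * U), vecOf (W * Z * U)}
  resolution : T * Tᴴ = 1
  eigen : W * Z * T = W * T * Matrix.diagonal l

namespace IsPencil

variable {I ι : Type*} [Fintype ι] [DecidableEq ι] {V : Submodule ℂ (I × Fin 3 → ℂ)}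
  {W : Matrix I (Fin 3) ℂ} {Z U : Matrix (Fin 3) (Fin 3) ℂ} {T : Matrix (Fin 3) ι ℂ} {l : ι → ℂ}

lemma rotate (h : IsPencil V W Z U T l) {R : Matrix (Fin 3) (Fin 3) ℂ}
    (hR : R ∈ Matrix.unitaryGroup (Fin 3) ℂ) :
    IsPencil V (W * R) (Rᴴ * Z * R) (Rᴴ * U) (Rᴴ * T) l := by
  have hR1 : R * Rᴴ = 1 := Matrix.mem_unitaryGroup_iff.mp hR
  have hR2 : Rᴴ * R = 1 := mul_eq_one_comm.mp hR1
  have hWZ : W * R * (Rᴴ * Z * R) = W * Z * R := by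
    rw [Matrix.mul_assoc Rᴴ, mul_mul_mul_of_mul_eq_one hR1, Matrix.mul_assoc]
  refine ⟨mul_mem (Unitary.star_mem hR) h.unitary, ?_, ?_, ?_⟩
  · rw [hWZ, mul_mul_mul_of_mul_eq_one hR1, mul_mul_mul_of_mul_eq_one hR1, ← h.span]
  · rw [Matrix.conjTranspose_mul, Matrix.conjTranspose_conjTranspose, Matrix.mul_assoc,
      ← Matrix.mul_assoc T, h.resolution, Matrix.one_mul, hR2]
  · rw [hWZ, mul_mul_mul_of_mul_eq_one hR1, mul_mul_mul_of_mul_eq_one hR1, h.eigen]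

/-- `Z` matters only modulo the kernel of `W`, which allows discarding rows of `Z` that `W` kills.
-/
lemma congr_right (h : IsPencil V W Z U T l) {Z' : Matrix (Fin 3) (Fin 3) ℂ}
    (hZ : W * Z' = W * Z) : IsPencil V W Z' U T l :=
  ⟨h.unitary, hZ ▸ h.span, h.resolution, hZ ▸ h.eigen⟩

lemma shift (h : IsPencil V W Z U T l) (x : ℂ) {b : ℂ} (hb : b ≠ 0) :
    IsPencil V W (b • (Z - x • 1)) U T (fun n => b * (l n - x)) := by
  refine ⟨h.unitary, ?_, h.resolution, ?_⟩
  · have e : vecOf (W * (b • (Z - x • 1)) * U) =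
        b • vecOf (W * Z * U) + (-(b * x)) • vecOf (W * U) := by
      rw [← vecOf_smul, ← vecOf_smul, ← vecOf_add]
      congr 1
      rw [Matrix.mul_smul, Matrix.mul_sub, Matrix.mul_smul, Matrix.mul_one, Matrix.smul_mul,
        Matrix.sub_mul, Matrix.smul_mul, smul_sub, smul_smul, neg_smul, sub_eq_add_neg]
    rw [h.span, e]
    refine le_antisymm (Submodule.span_le.mpr ?_) (Submodule.span_le.mpr ?_)
    · rintro _ (rfl | rfl)
      · exact Submodule.subset_span (by simp)
      · refine Submodule.mem_span_pair.mpr ⟨x, b⁻¹, ?_⟩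
        rw [smul_add, smul_smul, smul_smul, inv_mul_cancel₀ hb, one_smul,
          show b⁻¹ * -(b * x) = -x by field_simp, neg_smul]
        abel
    · rintro _ (rfl | rfl)
      · exact Submodule.subset_span (by simp)
      · exact Submodule.mem_span_pair.mpr ⟨-(b * x), b, add_comm _ _⟩
  · have hd : Matrix.diagonal (fun n => b * (l n - x)) =
        b • (Matrix.diagonal l - x • (1 : Matrix ι ι ℂ)) := by
      ext i j
      by_cases hij : i = j
      · subst hij; simp
      · simp [hij]
    rw [hd, Matrix.mul_smul, Matrix.mul_sub, Matrix.mul_smul, Matrix.mul_one, Matrix.smul_mul,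
      Matrix.sub_mul, Matrix.smul_mul, Matrix.mul_smul, Matrix.mul_sub, Matrix.mul_smul,
      Matrix.mul_one, h.eigen]

lemma diagConvertible_of_normal [Fintype I] (h : IsPencil V W Z U T l) (hV : Module.finrank ℂ V = 2)
    (hZ : Z * Zᴴ = Zᴴ * Z) : DiagConvertible V := by
  obtain ⟨S, hS, c, rfl⟩ := exists_unitary_diagonalization hZ
  have hS1 : S * Sᴴ = 1 := Matrix.mem_unitaryGroup_iff.mp hS
  refine diagConvertible_of_diagonal hV (W * S) (fun _ => 1) c
    (mul_mem (Unitary.star_mem hS) h.unitary :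
      Sᴴ * U ∈ Matrix.unitaryGroup (Fin 3) ℂ) ?_
  have e1 : W * S * Matrix.diagonal (fun _ : Fin 3 => (1 : ℂ)) * (Sᴴ * U) = W * U := by
    rw [Matrix.diagonal_one, Matrix.mul_one, Matrix.mul_assoc, ← Matrix.mul_assoc S, hS1,
      Matrix.one_mul]
  have e2 : W * S * Matrix.diagonal c * (Sᴴ * U) = W * (S * Matrix.diagonal c * Sᴴ) * U := by
    simp only [Matrix.mul_assoc]
  rw [e1, e2, h.span]

/-- Cancelling `W` leaves genuine eigenvectors of `Z`, so the inequality with `Q = 1` shows that `Z`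
is normal. -/
lemma diagConvertible_of_injective [Fintype I] (h : IsPencil V W Z U T l)
    (hV : Module.finrank ℂ V = 2) (hW : ∀ x, W *ᵥ x = 0 → x = 0) : DiagConvertible V := by
  refine h.diagConvertible_of_normal hV (normal_of_posSemidef ?_)
  have := posSemidef_of_resolution (Q := 1) (Z := Z) (T := T) (l := l)
    Matrix.conjTranspose_one (Matrix.one_mul _) h.resolution ?_
  · rwa [Matrix.mul_one] at this
  · ext i n
    have e := h.eigen
    rw [Matrix.mul_assoc, Matrix.mul_assoc, ← sub_eq_zero, ← Matrix.mul_sub] at e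
    have := hW ((Z * T - T * Matrix.diagonal l).col n) (by
      ext i; exact congrFun (congrFun e i) n)
    rw [Matrix.one_mul]
    exact sub_eq_zero.mp (congrFun this i)

/-- All rows are proportional here: `W X` has every column a multiple of `a`, hence is a diagonal
matrix multiplied on the left by the matrix with all columns `a`. -/
lemma diagConvertible_of_rank_one [Fintype I] (h : IsPencil V W Z U T l) (hV : Module.finrank ℂ V = 2)
    (a : I → ℂ) (c : Fin 3 → ℂ) (hW : ∀ i j, W i j = a i * c j) : DiagConvertible V := by
  have hWv : W = Matrix.vecMulVec a c := by ext i j; exact hW i j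
  refine diagConvertible_of_diagonal hV (Matrix.of fun i _ => a i) (c ᵥ* U) (c ᵥ* (Z * U))
    (one_mem _) ?_
  have e : ∀ X : Matrix (Fin 3) (Fin 3) ℂ,
      (Matrix.of fun i (_ : Fin 3) => a i) * Matrix.diagonal (c ᵥ* X) *
        (1 : Matrix (Fin 3) (Fin 3) ℂ) = W * X := by
    intro X
    rw [hWv, Matrix.vecMulVec_mul, Matrix.mul_one]
    ext i j
    simp [Matrix.vecMulVec_apply]
  rw [e, e, ← Matrix.mul_assoc, h.span]

/-- The projection of `ℂ^3` onto its first two coordinates. -/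
def _root_.planeProj : Matrix (Fin 3) (Fin 3) ℂ := Matrix.diagonal ![1, 1, 0]

open scoped ComplexOrder in
-- Here `W` can be cancelled only in the first two coordinates, so the inequality is used with `Q =
-- planeProj`.
lemma posSemidef_of_plane (h : IsPencil V W Z U T l)
    (hW : ∀ x, W *ᵥ x = 0 → x 0 = 0 ∧ x 1 = 0) (hZ : ∀ j, Z 2 j = 0) :
    (Z * Zᴴ - (Z * planeProj)ᴴ * (Z * planeProj)).PosSemidef := by
  refine posSemidef_of_resolution (T := T) (l := l) ?_ ?_ h.resolution ?_
  · rw [planeProj, Matrix.diagonal_conjTranspose]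
    congr 1
    ext i
    fin_cases i <;> simp
  · ext i j
    rw [planeProj, Matrix.diagonal_mul]
    fin_cases i <;> simp [hZ]
  · have e := h.eigen
    rw [Matrix.mul_assoc, Matrix.mul_assoc, ← sub_eq_zero, ← Matrix.mul_sub] at e
    ext i n
    have := hW ((Z * T - T * Matrix.diagonal l).col n) (by
      ext i; exact congrFun (congrFun e i) n)
    rw [Matrix.mul_assoc, planeProj, Matrix.diagonal_mul]
    fin_cases i
    · simpa using sub_eq_zero.mp this.1
    · simpa using sub_eq_zero.mp this.2
    · simp [Matrix.mul_apply, hZ]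

open scoped ComplexOrder in
-- The (0,0) entry of the inequality is `-|Z₁₀|²`, so `Z₁₀ = 0`. Columns 1 and 2 of both `W` and `W
-- Z` are then multiples of column 1 of `W`, and repeating that column makes both diagonal.
lemma diagConvertible_of_lower [Fintype I] (h : IsPencil V W Z U T l) (hV : Module.finrank ℂ V = 2)
    (hW : ∀ x, W *ᵥ x = 0 → x 0 = 0 ∧ x 1 = 0) (hW2 : ∀ i, W i 2 = 0) (hZ : ∀ j, Z 2 j = 0)
    (h01 : Z 0 1 = 0) (h02 : Z 0 2 = 0) : DiagConvertible V := by
  have h10 : Z 1 0 = 0 := by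
    have := (h.posSemidef_of_plane hW hZ).diag_nonneg (i := 0)
    simp only [Matrix.sub_apply, Matrix.mul_apply, Fin.sum_univ_three, planeProj,
      Matrix.conjTranspose_apply, h01, h02, hZ] at this
    have e : Z 0 0 * star (Z 0 0) - star (Z 0 0) * Z 0 0 - star (Z 1 0) * Z 1 0 =
        ((-Complex.normSq (Z 1 0) : ℝ) : ℂ) := by
      rw [Complex.ofReal_neg, Complex.normSq_eq_conj_mul_self, Complex.star_def]
      ring
    have e' : (0 : ℂ) ≤ ((-Complex.normSq (Z 1 0) : ℝ) : ℂ) := by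
      rw [← e]
      convert this using 1
      simp
      ring
    have e'' : 0 ≤ -Complex.normSq (Z 1 0) := by exact_mod_cast e'
    exact Complex.normSq_eq_zero.mp (le_antisymm (by linarith) (Complex.normSq_nonneg _))
  refine diagConvertible_of_diagonal hV (Matrix.of fun i => ![W i 0, W i 1, W i 1]) ![1, 1, 0]
    ![Z 0 0, Z 1 1, Z 1 2] h.unitary ?_
  have e1 : (Matrix.of fun i => ![W i 0, W i 1, W i 1]) *
      Matrix.diagonal (![1, 1, 0] : Fin 3 → ℂ) = W := by
    ext i j
    rw [Matrix.mul_diagonal]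
    fin_cases j <;> simp [hW2]
  have e2 : (Matrix.of fun i => ![W i 0, W i 1, W i 1]) *
      Matrix.diagonal ![Z 0 0, Z 1 1, Z 1 2] = W * Z := by
    ext i j
    rw [Matrix.mul_diagonal, Matrix.mul_apply, Fin.sum_univ_three]
    fin_cases j <;> simp [hW2, h01, h02, h10]
  rw [e1, e2, h.span]

end IsPencil

/-! ### Reduction of rank-two pencils to the two-qubit model. -/

/-- Being convertible from one of the two-qubit models. -/
def QubitConvertible {I : Type*} [Fintype I] (V : Submodule ℂ (I × Fin 3 → ℂ)) : Prop :=
  ∃ d f θ g : ℝ, 0 < g ∧ 0 ≤ d ∧ 0 ≤ f ∧ 0 ≤ θ ∧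
    0 ≤ -1 - f ^ 2 + g ^ 2 - d ^ 2 * (-2 + d ^ 2 + f ^ 2 + g ^ 2)
      + 2 * d * f ^ 2 * Real.cos (2 * θ) ∧
    EBConvertible (ebModel₃ d f θ g) V

lemma re_polar (f θ : ℝ) : ((f : ℂ) * Complex.exp (Complex.I * θ)).re = f * Real.cos θ := by
  rw [mul_comm Complex.I, Complex.re_ofReal_mul, Complex.exp_ofReal_mul_I_re]

lemma im_polar (f θ : ℝ) : ((f : ℂ) * Complex.exp (Complex.I * θ)).im = f * Real.sin θ := by
  rw [mul_comm Complex.I, Complex.im_ofReal_mul, Complex.exp_ofReal_mul_I_im]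

lemma polar_inequality_eq (d f θ g : ℝ) :
    -1 - f ^ 2 + g ^ 2 - d ^ 2 * (-2 + d ^ 2 + f ^ 2 + g ^ 2) + 2 * d * f ^ 2 * Real.cos (2 * θ) =
      -1 - ((f * Real.cos θ) ^ 2 + (f * Real.sin θ) ^ 2) + g ^ 2
        - d ^ 2 * (-2 + d ^ 2 + ((f * Real.cos θ) ^ 2 + (f * Real.sin θ) ^ 2) + g ^ 2)
        + 2 * d * ((f * Real.cos θ) ^ 2 - (f * Real.sin θ) ^ 2) := by
  have h := Real.sin_sq_add_cos_sq θ
  rw [Real.cos_two_mul']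
  linear_combination (f ^ 2 + d ^ 2 * f ^ 2) * h

lemma exists_polar (z : ℂ) : ∃ f θ : ℝ, 0 ≤ f ∧ 0 ≤ θ ∧ z = f * Complex.exp (Complex.I * θ) := by
  -- The shift by `2π` makes the angle nonnegative.
  refine ⟨‖z‖, Complex.arg z + 2 * Real.pi, norm_nonneg z, ?_, ?_⟩
  · linarith [Complex.neg_pi_lt_arg z, Real.pi_pos]
  · have : Complex.I * ((Complex.arg z + 2 * Real.pi : ℝ) : ℂ) =
        Complex.arg z * Complex.I + 2 * Real.pi * Complex.I := by
      push_cast; ring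
    rw [this, Complex.exp_add, Complex.exp_two_pi_mul_I, mul_one, Complex.norm_mul_exp_arg_mul_I]

lemma hasProductResolution_ebModel₃ {d f θ g : ℝ} (hg : 0 < g) (hd : 0 ≤ d)
    (h : 0 ≤ -1 - f ^ 2 + g ^ 2 - d ^ 2 * (-2 + d ^ 2 + f ^ 2 + g ^ 2)
      + 2 * d * f ^ 2 * Real.cos (2 * θ)) : HasProductResolution (ebModel₃ d f θ g) := by
  rw [ebModel₃_eq]
  refine hasProductResolution_qubit hd hg ?_
  rw [re_polar, im_polar, ← polar_inequality_eq]
  exact h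

lemma exists_phase_mul (w : ℂ) : ∃ u : ℂ, u * star u = 1 ∧ u * w = ‖w‖ := by
  by_cases hw : w = 0
  · exact ⟨1, by simp, by simp [hw]⟩
  · have hn : (‖w‖ : ℂ) ≠ 0 := by exact_mod_cast norm_ne_zero_iff.mpr hw
    have e : w * star w = (‖w‖ : ℂ) ^ 2 := Complex.mul_conj' w
    refine ⟨star w / ‖w‖, ?_, ?_⟩
    · rw [star_div₀, star_star, Complex.star_def, Complex.conj_ofReal, ← Complex.star_def]
      field_simp
      linear_combination e
    · field_simp
      linear_combination e

lemma exists_phase_sq_mul (w : ℂ) : ∃ u : ℂ, u * star u = 1 ∧ star u ^ 2 * w = ‖w‖ := by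
  obtain ⟨s, hs, hsw⟩ := exists_phase_mul w
  obtain ⟨r, hr⟩ := IsAlgClosed.exists_pow_nat_eq s (n := 2) (by norm_num)
  refine ⟨star r, ?_, by rw [star_star, hr, hsw]⟩
  have h1 : ‖s‖ = 1 := by
    have : s * star s = (‖s‖ : ℂ) ^ 2 := Complex.mul_conj' s
    rw [this] at hs
    have : ‖s‖ ^ 2 = 1 := by exact_mod_cast hs
    exact (pow_eq_one_iff_of_nonneg (norm_nonneg _) two_ne_zero).mp this
  have h2 : ‖r‖ ^ 2 = 1 := by rw [← norm_pow, hr, h1]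
  have h3 : r * star r = (‖r‖ : ℂ) ^ 2 := Complex.mul_conj' r
  rw [star_star, mul_comm, h3]
  exact_mod_cast h2

namespace IsPencil

variable {I ι : Type*} [Fintype ι] [DecidableEq ι] {V : Submodule ℂ (I × Fin 3 → ℂ)}
  {W : Matrix I (Fin 3) ℂ} {Z U : Matrix (Fin 3) (Fin 3) ℂ} {T : Matrix (Fin 3) ι ℂ} {l : ι → ℂ}

open scoped ComplexOrder in
-- The expression is the determinant of the upper left 2×2 block of the positive semidefinite matrix
-- from `posSemidef_of_plane`.
lemma qubit_inequality {d g : ℝ} {z : ℂ}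
    (h : IsPencil V W !![0, 1, 0; (d : ℂ), z, g; 0, 0, 0] U T l)
    (hW : ∀ x, W *ᵥ x = 0 → x 0 = 0 ∧ x 1 = 0) :
    0 ≤ -1 - (z.re ^ 2 + z.im ^ 2) + g ^ 2
      - d ^ 2 * (-2 + d ^ 2 + (z.re ^ 2 + z.im ^ 2) + g ^ 2) + 2 * d * (z.re ^ 2 - z.im ^ 2) := by
  have hN := h.posSemidef_of_plane hW (by intro j; fin_cases j <;> rfl)
  have hdet := (hN.submatrix (![0, 1] : Fin 2 → Fin 3)).det_nonneg
  have e : ∀ X : Matrix (Fin 3) (Fin 3) ℂ, X = !![0, 1, 0; (d : ℂ), z, g; 0, 0, 0] →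
      ((X * Xᴴ - (X * planeProj)ᴴ * (X * planeProj)).submatrix ![0, 1] ![0, 1]).det =
      ((-1 - (z.re ^ 2 + z.im ^ 2) + g ^ 2
      - d ^ 2 * (-2 + d ^ 2 + (z.re ^ 2 + z.im ^ 2) + g ^ 2)
      + 2 * d * (z.re ^ 2 - z.im ^ 2) : ℝ) : ℂ) := by
    intro X hX
    obtain ⟨x, y, rfl⟩ : ∃ x y : ℝ, z = x + y * Complex.I :=
      ⟨z.re, z.im, (Complex.re_add_im z).symm⟩
    have hP : ∀ i j, (X * planeProj) i j = X i j * ![1, 1, 0] j := fun i j => by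
      rw [planeProj, Matrix.mul_diagonal]
    generalize X * planeProj = Y at hP ⊢
    rw [Matrix.det_fin_two]
    simp only [Matrix.submatrix_apply, Matrix.sub_apply, Matrix.mul_apply, Matrix.conjTranspose_apply, Fin.sum_univ_three, hP]
    simp [hX]
    linear_combination ((d : ℂ) ^ 2 * y ^ 2 + 2 * d * y ^ 2 + y ^ 2) * Complex.I_sq
  rw [e _ rfl] at hdet
  exact_mod_cast hdet

lemma qubitConvertible [Fintype I] {d g : ℝ} {z : ℂ}
    (h : IsPencil V W !![0, 1, 0; (d : ℂ), z, g; 0, 0, 0] U T l)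
    (hV : Module.finrank ℂ V = 2) (hW : ∀ x, W *ᵥ x = 0 → x 0 = 0 ∧ x 1 = 0)
    (hW2 : ∀ i, W i 2 = 0) (hd : 0 ≤ d) (hg : 0 < g) : QubitConvertible V := by
  have hineq := h.qubit_inequality hW
  obtain ⟨f, θ, hf, hθ, rfl⟩ := exists_polar z
  rw [re_polar, im_polar, ← polar_inequality_eq] at hineq
  refine ⟨d, f, θ, g, hg, hd, hf, hθ, hineq, ?_⟩
  rw [ebModel₃_eq]
  refine ebConvertible_of_span_pair hV h.span W h.unitary 1 0 0 1 ?_ ?_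
  · rw [one_smul, zero_smul, add_zero]
    congr 1
    ext i j
    rw [Matrix.mul_apply, Fin.sum_univ_three]
    fin_cases j <;> simp [hW2]
  · rw [one_smul, zero_smul, zero_add]

lemma _root_.plane_kernel_rotate {R : Matrix (Fin 3) (Fin 3) ℂ}
    (hR : R ∈ Matrix.unitaryGroup (Fin 3) ℂ) (h0 : R 2 0 = 0) (h1 : R 2 1 = 0)
    (hW : ∀ x, W *ᵥ x = 0 → x 0 = 0 ∧ x 1 = 0) :
    ∀ x, (W * R) *ᵥ x = 0 → x 0 = 0 ∧ x 1 = 0 := by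
  intro x hx
  rw [← Matrix.mulVec_mulVec] at hx
  obtain ⟨e0, e1⟩ := hW _ hx
  have hR2 : Rᴴ * R = 1 := Matrix.mem_unitaryGroup_iff'.mp hR
  have e : x = Rᴴ *ᵥ (R *ᵥ x) := by rw [Matrix.mulVec_mulVec, hR2, Matrix.one_mulVec]
  generalize R *ᵥ x = y at *
  subst e
  simp [Matrix.mulVec, dotProduct, Fin.sum_univ_three, h0, h1, e0, e1]

lemma convertible_of_last_column [Fintype I] (h : IsPencil V W Z U T l)
    (hV : Module.finrank ℂ V = 2)
    (hW : ∀ x, W *ᵥ x = 0 → x 0 = 0 ∧ x 1 = 0) (hW2 : ∀ i, W i 2 = 0) (hZ : ∀ j, Z 2 j = 0)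
    (h02 : Z 0 2 = 0) (h12 : Z 1 2 ≠ 0) : DiagConvertible V ∨ QubitConvertible V := by
  by_cases h01 : Z 0 1 = 0
  · exact Or.inl (h.diagConvertible_of_lower hV hW hW2 hZ h01 h02)
  right
  -- Subtracting `Z₀₀` and dividing by `Z₀₁ u` makes the first row `(0, 1, 0)`. The phase `u` enters
  -- the (1,0) entry as `conj(u)²` and makes it nonnegative; `v` does the same for the (1,2) entry.
  obtain ⟨u, hu, hud⟩ := exists_phase_sq_mul (Z 1 0 / Z 0 1)
  obtain ⟨v, hv, hvg⟩ := exists_phase_mul (star u ^ 2 * (Z 1 2 / Z 0 1))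
  have hu0 : u ≠ 0 := left_ne_zero_of_mul_eq_one hu
  have hus : star u ≠ 0 := right_ne_zero_of_mul_eq_one hu
  have huinv : u⁻¹ = star u := inv_eq_of_mul_eq_one_right hu
  let R : Matrix (Fin 3) (Fin 3) ℂ := Matrix.diagonal ![1, u, v]
  have hR : R ∈ Matrix.unitaryGroup (Fin 3) ℂ := by
    rw [Matrix.mem_unitaryGroup_iff, Matrix.star_eq_conjTranspose, Matrix.diagonal_conjTranspose,
      Matrix.diagonal_mul_diagonal, ← Matrix.diagonal_one]
    congr 1
    ext i
    fin_cases i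
    · simp
    · exact hu
    · exact hv
  have hW2' : ∀ i, (W * R) i 2 = 0 := fun i => by simp [R, hW2]
  have hp := (h.rotate hR).shift (Z 0 0) (b := (Z 0 1 * u)⁻¹) (inv_ne_zero (mul_ne_zero h01 hu0))
  refine (hp.congr_right (Z' := !![0, 1, 0;
    ((‖Z 1 0 / Z 0 1‖ : ℝ) : ℂ), (Z 0 1 * u)⁻¹ * (star u * Z 1 1 * u - Z 0 0),
      ((‖star u ^ 2 * (Z 1 2 / Z 0 1)‖ : ℝ) : ℂ); 0, 0, 0]) ?_).qubitConvertible hV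
    (plane_kernel_rotate hR (by simp [R]) (by simp [R]) hW) hW2' (norm_nonneg _)
    (norm_pos_iff.mpr (mul_ne_zero (pow_ne_zero 2 hus) (div_ne_zero h12 h01)))
  ext i j
  rw [Matrix.mul_apply, Matrix.mul_apply, Fin.sum_univ_three, Fin.sum_univ_three, hW2', zero_mul,
    zero_mul, ← hud, ← hvg]
  have hent : ∀ i j, (Rᴴ * Z * R) i j = star (![1, u, v] i) * Z i j * ![1, u, v] j := by
    intro i j
    rw [Matrix.diagonal_conjTranspose, Matrix.mul_diagonal, Matrix.diagonal_mul]
    rfl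
  simp only [Matrix.smul_apply, Matrix.sub_apply, hent]
  congr 2
  · congr 1
    fin_cases j
    · simp [Matrix.one_apply]
    · simp
      field_simp
    · simp [h02]
  · congr 1
    fin_cases j
    · simp [huinv]
      ring
    · simp [Matrix.one_apply]
    · simp [huinv]
      ring

lemma convertible [Fintype I] (h : IsPencil V W Z U T l) (hV : Module.finrank ℂ V = 2) :
    DiagConvertible V ∨ QubitConvertible V := by
  by_cases hinj : ∀ x, W *ᵥ x = 0 → x = 0
  · exact Or.inl (h.diagConvertible_of_injective hV hinj)
  push Not at hinj
  obtain ⟨x, hx, hx0⟩ := hinj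
  obtain ⟨r, -, hk, -⟩ := exists_isUnitVec_smul hx0
  obtain ⟨R, hR, hRk⟩ := exists_unitary_col_eq hk 2
  have hW2 : ∀ i, (W * R) i 2 = 0 := by
    intro i
    have e : (W * R).col 2 = 0 := by
      have : (W * R).col 2 = W *ᵥ R.col 2 := rfl
      rw [this, show R.col 2 = _ from funext hRk, Matrix.mulVec_smul, hx, smul_zero]
    exact congrFun e i
  have h₁ := h.rotate hR
  -- With the kernel vector moved to the last position, the last row of `Z` is invisible to `W` and
  -- can be set to zero.
  have h₂ := h₁.congr_right (Z' := planeProj * (Rᴴ * Z * R)) (by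
    rw [← Matrix.mul_assoc]
    congr 1
    ext i j
    rw [planeProj, Matrix.mul_diagonal]
    fin_cases j <;> simp [hW2])
  have hZ2 : ∀ j, (planeProj * (Rᴴ * Z * R)) 2 j = 0 := fun j => by
    rw [planeProj, Matrix.diagonal_mul]; simp
  clear h₁ h
  generalize planeProj * (Rᴴ * Z * R) = Z₁ at *
  generalize W * R = W₁ at *
  by_cases hW : ∀ x, W₁ *ᵥ x = 0 → x 0 = 0 ∧ x 1 = 0
  · by_cases hy : Z₁ 0 2 = 0 ∧ Z₁ 1 2 = 0
    · refine Or.inl (h₂.diagConvertible_of_normal hV (normal_of_posSemidef ?_))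
      have e : Z₁ * planeProj = Z₁ := by
        ext i j
        rw [planeProj, Matrix.mul_diagonal]
        fin_cases i <;> fin_cases j <;> simp [hy.1, hy.2, hZ2]
      have := h₂.posSemidef_of_plane hW hZ2
      rwa [e] at this
    · have hy0 : ![Z₁ 0 2, Z₁ 1 2] ≠ 0 := by
        intro e
        exact hy ⟨congrFun e 0, congrFun e 1⟩
      obtain ⟨s, hs, hsu, -⟩ := exists_isUnitVec_smul hy0
      have hs0 : (s : ℂ) ≠ 0 := by exact_mod_cast hs.ne'
      have hpq : star (Z₁ 0 2) * Z₁ 0 2 + star (Z₁ 1 2) * Z₁ 1 2 = s ^ 2 := by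
        simp [IsUnitVec, dotProduct, Fin.sum_univ_two] at hsu
        simp only [Complex.star_def]
        field_simp at hsu
        linear_combination hsu
      -- This rotation sends the last column `(Z₀₂, Z₁₂)` to `(0, s)`.
      have hP := planeRotation_mem_unitaryGroup (p := star (Z₁ 1 2) / s) (q := -star (Z₁ 0 2) / s)
        (by
          simp only [Complex.star_def] at hpq
          simp
          field_simp
          linear_combination hpq)
      refine (h₂.rotate hP).convertible_of_last_column hV
        (plane_kernel_rotate hP (by simp [planeRotation]) (by simp [planeRotation]) hW) ?_ ?_ ?_ ?_
      · intro i
        simp [Matrix.mul_apply, Fin.sum_univ_three, planeRotation, hW2]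
      · intro j
        rw [Matrix.mul_assoc, Matrix.mul_apply, Fin.sum_univ_three]
        simp [Matrix.mul_apply, Fin.sum_univ_three, planeRotation, hZ2]
      · rw [Matrix.mul_assoc, Matrix.mul_apply, Fin.sum_univ_three]
        simp [Matrix.mul_apply, Fin.sum_univ_three, planeRotation, hZ2]
        ring
      · have e : ((planeRotation (star (Z₁ 1 2) / s) (-star (Z₁ 0 2) / s))ᴴ * Z₁ *
            planeRotation (star (Z₁ 1 2) / s) (-star (Z₁ 0 2) / s)) 1 2 = s := by
          rw [Matrix.mul_assoc, Matrix.mul_apply, Fin.sum_univ_three]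
          simp [Matrix.mul_apply, Fin.sum_univ_three, planeRotation, hZ2]
          simp only [Complex.star_def] at hpq
          field_simp
          linear_combination hpq
        rw [e]
        exact hs0
  · left
    -- A second kernel direction exists, so `W₁` has rank at most one.
    push Not at hW
    obtain ⟨x, hx, hne⟩ := hW
    have hx' : ∀ i, W₁ i 0 * x 0 + W₁ i 1 * x 1 = 0 := by
      intro i
      have := congrFun hx i
      simpa [Matrix.mulVec, dotProduct, Fin.sum_univ_three, hW2] using this
    by_cases h0 : x 0 = 0
    · have h1 := hne h0
      refine h₂.diagConvertible_of_rank_one hV (fun i => W₁ i 0) ![1, 0, 0] fun i j => ?_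
      have e : W₁ i 1 = 0 := by simpa [h0, h1] using hx' i
      fin_cases j <;> simp [hW2, e]
    · refine h₂.diagConvertible_of_rank_one hV (fun i => W₁ i 1) ![-x 1 / x 0, 1, 0]
        fun i j => ?_
      fin_cases j
      · simp
        field_simp
        linear_combination hx' i
      · simp
      · simp [hW2]

end IsPencil

/-! ### Assembly. -/

lemma IsEBSpace.convertible {I : Type*} [Fintype I] {V : Submodule ℂ (I × Fin 3 → ℂ)}
    (h : IsEBSpace V) (hV : Module.finrank ℂ V = 2) :
    DiagConvertible V ∨ QubitConvertible V := by
  let b := Module.finBasisOfFinrankEq ℂ V hV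
  let M : Matrix I (Fin 3) ℂ := Matrix.of fun i j => (b 0 : I × Fin 3 → ℂ) (i, j)
  let N : Matrix I (Fin 3) ℂ := Matrix.of fun i j => (b 1 : I × Fin 3 → ℂ) (i, j)
  have hM : vecOf M = b 0 := rfl
  have hN : vecOf N = b 1 := rfl
  have hspan : V = Submodule.span ℂ {vecOf M, vecOf N} := by
    have := congrArg (Submodule.map V.subtype) b.span_eq
    rw [Submodule.map_span, Submodule.map_top, Submodule.range_subtype, ← Set.range_comp] at this
    rw [hM, hN, ← Matrix.range_cons_cons_empty _ _ ![]]
    refine this.symm.trans ?_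
    congr 2
    ext i : 1
    fin_cases i <;> rfl
  have hM0 : M ≠ 0 := by
    intro e
    refine b.ne_zero 0 (Subtype.ext ?_)
    rw [← hM, e]
    rfl
  obtain ⟨n, T, hT⟩ := h.exists_isProductResolution (M := M) (N := N) (hM ▸ (b 0).2)
    (hN ▸ (b 1).2) hM0
  obtain ⟨x, l, hl⟩ := hT.exists_eigen
  -- `Z = T L Tᴴ` is the compression of the eigenvalue matrix; it divides `N` by `M + x N` even if
  -- the latter is not injective.
  have hZ : (M + x • N) * (T * Matrix.diagonal l * Tᴴ) = N := by
    rw [← Matrix.mul_assoc, ← Matrix.mul_assoc, ← hl, Matrix.mul_assoc, hT.1, Matrix.mul_one]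
  refine IsPencil.convertible (W := M + x • N) (Z := T * Matrix.diagonal l * Tᴴ) (U := 1) (T := T)
    (l := l) ⟨one_mem _, ?_, hT.1, ?_⟩ hV
  · rw [hZ, Matrix.mul_one, Matrix.mul_one, hspan, vecOf_add, vecOf_smul]
    refine le_antisymm (Submodule.span_le.mpr ?_) (Submodule.span_le.mpr ?_)
    · rintro _ (rfl | rfl)
      · exact Submodule.mem_span_pair.mpr ⟨1, -x, by rw [one_smul, neg_smul]; abel⟩
      · exact Submodule.subset_span (by simp)
    · rintro _ (rfl | rfl)
      · exact Submodule.mem_span_pair.mpr ⟨1, x, by rw [one_smul]⟩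
      · exact Submodule.subset_span (by simp)
  · rw [hZ, hl]

end

theorem mainTheorem2 (m : ℕ) (V : Submodule ℂ (Fin m × Fin 3 → ℂ))
    (hV : Module.finrank ℂ V = 2) :
    IsEBSpace V ↔
      EBConvertible ebModel₁ V ∨ EBConvertible ebModel₂ V ∨
        ∃ d f θ g : ℝ, 0 < g ∧ 0 ≤ d ∧ 0 ≤ f ∧ 0 ≤ θ ∧
          0 ≤ -1 - f ^ 2 + g ^ 2 - d ^ 2 * (-2 + d ^ 2 + f ^ 2 + g ^ 2)
            + 2 * d * f ^ 2 * Real.cos (2 * θ) ∧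
          EBConvertible (ebModel₃ d f θ g) V := by
  constructor
  · intro h
    exact or_assoc.mp (h.convertible hV)
  · rintro (h | h | ⟨d, f, θ, g, hg, hd, -, -, hineq, h⟩)
    · exact (HasProductResolution.of_ebConvertible
        (ebModel₁_eq ▸ hasProductResolution_diagonal _ _) h).isEBSpace
    · exact (HasProductResolution.of_ebConvertible
        (ebModel₂_eq ▸ hasProductResolution_diagonal _ _) h).isEBSpace
    · exact ((hasProductResolution_ebModel₃ hg hd hineq).of_ebConvertible h).isEBSpace
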